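/- Let $X$ be a finite-dimensional real normed space and let $K\subseteq X$ be a closed polyhedral cone: a closed convex set with $\lambda K\subseteq K$ for all $\lambda>0$ and $K\cap(-K)=\{0\}$, having only finitely many extreme rays. Write $x\le y$ if $y-x\in K$. A map $f:K\to K$ is order-preserving if $x\le y$ implies $f(x)\le f(y)$, and homogeneous if $f(cx)=cf(x)$ for all $c>0$, $x\in K$. For a continuous homogeneous map $f:K\to K$ put $\|f\|=\sup\{\|f(x)\|:x\in K,\ \|x\|=1\}$ (with $\sup\emptyset=0$), and let $$r(f)=\lim_{n\to\infty}\|f^n\|^{1/n}=\inf_{n>0}\|f^n\|^{1/n}$$ be its cone spectral radius. For a family $\mathcal{A}$ of such maps let $\mathcal{A}^n=\{f_n\circ\cdots\circ f_1: f_i\in\mathcal{A}\}$ and let $$r(\mathcal{A})=\limsup_{n\to\infty}\ \sup_{f\in\mathcal{A}^n} r(f)^{1/n}$$ be its generalized spectral radius. Let $\Omega_1=\{x\in K:\|x\|\le 1\}$, and let $C(\Omega_1,X)$ be the space of continuous maps $\Omega_1\to X$ with the supremum norm. A nonempty family of continuous homogeneous maps $K\to K$ is called compact if the set of restrictions of its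 members to $\Omega_1$ is compact in $C(\Omega_1,X)$. **Theorem.** Let $(\mathcal{A}_k)_{k\in\mathbb{N}}$ be a sequence of nonempty compact families of continuous, order-preserving, homogeneous maps $K\to K$, and let $\mathcal{A}$ be a nonempty compact family of continuous homogeneous maps $K\to K$. If $\mathcal{A}_k$ converges to $\mathcal{A}$ in the Hausdorff metric on $C(\Omega_1,X)$, that is, if the Hausdorff distance between the sets of restrictions to $\Omega_1$ tends to $0$, then $$\lim_{k\to\infty} r(\mathcal{A}_k)=r(\mathcal{A}).$$ -/

import Mathlib

open Set Filter Topology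

noncomputable section

namespace ConeMaps

variable {X : Type*} [NormedAddCommGroup X] [NormedSpace ℝ X]

/-- `R` is an extreme ray of the closed cone `K`: a ray `{c • x : c ≥ 0}` with `x ≠ 0` that is an
extreme subset (a face) of `K`. -/
def IsExtremeRay (K : ProperCone ℝ X) (R : Set X) : Prop :=
  (∃ x : X, x ≠ 0 ∧ R = {y | ∃ c : ℝ, 0 ≤ c ∧ y = c • x}) ∧ IsExtreme ℝ (K : Set X) R

/-- `K` is a closed polyhedral cone. A `ProperCone` of Mathlib is a closed convex set that contains
`0` and is stable under multiplication by nonnegative reals; here it moreover satisfies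
`K ∩ (-K) = {0}` and has only finitely many extreme rays. -/
structure IsPolyhedralCone (K : ProperCone ℝ X) : Prop where
  inter_neg : (K : Set X) ∩ -(K : Set X) = {0}
  finite_extremeRays : {R : Set X | IsExtremeRay K R}.Finite

variable {K : ProperCone ℝ X}

/-- `f x ≤ f y` whenever `x ≤ y`, where `x ≤ y` means `y - x ∈ K`. -/
def OrderPreserving (f : K → K) : Prop :=
  ∀ x y : K, (y : X) - (x : X) ∈ K → (f y : X) - (f x : X) ∈ K

/-- `f (c x) = c f x` for all `c > 0` and `x ∈ K`. -/
def Homogeneous (f : K → K) : Prop :=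
  ∀ (c : ℝ) (hc : 0 < c) (x : K), (f ⟨c • (x : X), K.smul_mem x.2 hc.le⟩ : X) = c • (f x : X)

/-- `‖f‖ = sup {‖f x‖ : x ∈ K, ‖x‖ = 1}`. -/
def coneNorm (f : K → K) : ℝ :=
  sSup {t : ℝ | ∃ x : K, ‖(x : X)‖ = 1 ∧ t = ‖(f x : X)‖}

/-- The Bonsall cone spectral radius `r(f) = inf_{n > 0} ‖f ^ n‖ ^ (1 / n)`. For bounded homogeneous
maps this is the limit of `‖f ^ n‖ ^ (1 / n)`: see `tendsto_coneSpectralRadius`. -/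
def coneSpectralRadius (f : K → K) : ℝ :=
  sInf {t : ℝ | ∃ n : ℕ, 0 < n ∧ t = coneNorm (f^[n]) ^ (1 / (n : ℝ))}

/-- `𝒜 ^ m`, the family of all compositions `f_m ∘ ⋯ ∘ f_1` with `f_i ∈ 𝒜`. -/
def familyPow (A : Set (K → K)) : ℕ → Set (K → K)
  | 0 => {id}
  | m + 1 => {h | ∃ f ∈ A, ∃ g ∈ familyPow A m, h = f ∘ g}

/-- The generalized spectral radius
`r(𝒜) = limsup_{n → ∞} sup {r(f) ^ (1 / n) : f ∈ 𝒜 ^ n}`. -/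
def generalizedSpectralRadius (A : Set (K → K)) : ℝ :=
  limsup (fun n : ℕ => sSup {t : ℝ | ∃ f ∈ familyPow A n, t = coneSpectralRadius f ^ (1 / (n : ℝ))})
    atTop

/-- `Ω_R = {x ∈ K : ‖x‖ ≤ R}`. -/
def Omega (K : ProperCone ℝ X) (R : ℝ) : Set X := {x | x ∈ K ∧ ‖x‖ ≤ R}

instance [FiniteDimensional ℝ X] (R : ℝ) : CompactSpace (Omega K R) := by
  have : ProperSpace X := FiniteDimensional.proper_real X
  refine isCompact_iff_compactSpace.mp ?_
  have h : Omega K R = (K : Set X) ∩ Metric.closedBall 0 R := by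
    ext x
    simp [Omega]
  rw [h]
  exact (isCompact_closedBall (0 : X) R).inter_left K.isClosed

/-- A family of maps `K → K`, viewed as a subset of `C(Ω₁, X)` by restricting its members. -/
def restrictFamily (A : Set (K → K)) : Set C(Omega K 1, X) :=
  {g | ∃ f ∈ A, ∀ x : Omega K 1, g x = (f ⟨x, x.2.1⟩ : X)}

/-- A nonempty compact family of continuous homogeneous maps `K → K`; compactness is that of the
restricted family in `C(Ω₁, X)` with the supremum norm. -/
structure IsCompactFamily [FiniteDimensional ℝ X] (A : Set (K → K)) : Prop where
  nonempty : A.Nonempty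
  continuous : ∀ f ∈ A, Continuous f
  homogeneous : ∀ f ∈ A, Homogeneous f
  isCompact : IsCompact (restrictFamily A)

/-- Fekete's lemma in multiplicative form. -/
theorem fekete_mul (u : ℕ → ℝ) (h0 : ∀ n, 0 ≤ u n) (hu : ∀ m n, u (m + n) ≤ u m * u n) :
    Tendsto (fun n : ℕ => u n ^ (1 / (n : ℝ))) atTop
      (𝓝 (sInf {t : ℝ | ∃ n : ℕ, 0 < n ∧ t = u n ^ (1 / (n : ℝ))})) := by
  set S := {t : ℝ | ∃ n : ℕ, 0 < n ∧ t = u n ^ (1 / (n : ℝ))} with hS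
  have hb : BddBelow S := ⟨0, by rintro t ⟨n, -, rfl⟩; exact Real.rpow_nonneg (h0 n) _⟩
  have hne : S.Nonempty := ⟨_, 1, one_pos, rfl⟩
  have hS0 : 0 ≤ sInf S :=
    le_csInf hne (by rintro t ⟨n, -, rfl⟩; exact Real.rpow_nonneg (h0 n) _)
  refine tendsto_order.2 ⟨fun a ha => ?_, fun a ha => ?_⟩
  · filter_upwards [eventually_gt_atTop 0] with n hn
    exact ha.trans_le (csInf_le hb ⟨n, hn, rfl⟩)
  · obtain ⟨b, hSb, hba⟩ := exists_between ha
    obtain ⟨t, ⟨m, hm, rfl⟩, htb⟩ := exists_lt_of_csInf_lt hne hSb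
    have hb0 : 0 < b := hS0.trans_lt hSb
    have hum : u m ≤ b ^ m := by
      have h1 : u m = (u m ^ (1 / (m : ℝ))) ^ m := by
        rw [one_div, Real.rpow_inv_natCast_pow (h0 m) hm.ne']
      rw [h1]
      exact pow_le_pow_left₀ (Real.rpow_nonneg (h0 m) _) htb.le m
    have hq : ∀ q r, u (q * m + r) ≤ u m ^ q * u r := by
      intro q r
      induction q with
      | zero => simp
      | succ q ih =>
        have e : (q + 1) * m + r = m + (q * m + r) := by ring
        rw [e]
        refine (hu _ _).trans ((mul_le_mul_of_nonneg_left ih (h0 m)).trans_eq ?_)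
        ring
    set C : ℝ := ∑ r ∈ Finset.range m, u r / b ^ r + 1 with hC
    have hsum : ∀ r ∈ Finset.range m, 0 ≤ u r / b ^ r := fun r _ =>
      div_nonneg (h0 r) (pow_nonneg hb0.le r)
    have hC0 : 0 < C := by
      have := Finset.sum_nonneg hsum
      linarith
    have hun : ∀ n, u n ≤ C * b ^ n := by
      intro n
      have hr : n % m ∈ Finset.range m := Finset.mem_range.2 (Nat.mod_lt _ hm)
      have h1 : u (n % m) / b ^ (n % m) ≤ C := by
        have := Finset.single_le_sum hsum hr
        linarith
      have h2 : u (n % m) ≤ C * b ^ (n % m) := (div_le_iff₀ (pow_pos hb0 _)).1 h1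
      have h3 := hq (n / m) (n % m)
      have e : n / m * m + n % m = n := Nat.div_add_mod' n m
      rw [e] at h3
      calc u n ≤ u m ^ (n / m) * u (n % m) := h3
        _ ≤ (b ^ m) ^ (n / m) * (C * b ^ (n % m)) :=
          mul_le_mul (pow_le_pow_left₀ (h0 m) hum _) h2 (h0 _) (by positivity)
        _ = C * b ^ (n / m * m + n % m) := by
          rw [pow_add, mul_comm (n / m) m, pow_mul]
          ring
        _ = C * b ^ n := by rw [e]
    have hlim : Tendsto (fun n : ℕ => C ^ (1 / (n : ℝ)) * b) atTop (𝓝 (C ^ (0 : ℝ) * b)) :=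
      ((Real.continuousAt_const_rpow hC0.ne').tendsto.comp
        tendsto_one_div_atTop_nhds_zero_nat).mul_const b
    rw [Real.rpow_zero, one_mul] at hlim
    filter_upwards [hlim.eventually_lt_const hba, eventually_gt_atTop 0] with n hn hn0
    refine lt_of_le_of_lt ?_ hn
    calc u n ^ (1 / (n : ℝ)) ≤ (C * b ^ n) ^ (1 / (n : ℝ)) :=
          Real.rpow_le_rpow (h0 n) (hun n) (by positivity)
      _ = C ^ (1 / (n : ℝ)) * b := by
          rw [Real.mul_rpow hC0.le (by positivity), one_div, Real.pow_rpow_inv_natCast hb0.le hn0.ne']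

theorem Homogeneous.map_zero {f : K → K} (hf : Homogeneous f) (x : K) (hx : (x : X) = 0) :
    (f x : X) = 0 := by
  have h := hf 2 two_pos x
  have e : (⟨(2 : ℝ) • (x : X), K.smul_mem x.2 two_pos.le⟩ : K) = x := by
    apply Subtype.ext
    simp [hx]
  rw [e, two_smul] at h
  simpa using h

theorem coneNorm_nonneg (f : K → K) : 0 ≤ coneNorm f :=
  Real.sSup_nonneg (by rintro t ⟨x, -, rfl⟩; exact norm_nonneg _)

theorem norm_le_coneNorm {f : K → K} (hf : Homogeneous f)
    (hb : BddAbove {t : ℝ | ∃ x : K, ‖(x : X)‖ = 1 ∧ t = ‖(f x : X)‖}) (x : K) :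
    ‖(f x : X)‖ ≤ coneNorm f * ‖(x : X)‖ := by
  rcases eq_or_ne (x : X) 0 with hx | hx
  · simp [hf.map_zero x hx, hx]
  · have hn : 0 < ‖(x : X)‖ := norm_pos_iff.2 hx
    have h := hf ‖(x : X)‖⁻¹ (inv_pos.2 hn) x
    have h1 := le_csSup hb ⟨_, by
      show ‖((⟨‖(x : X)‖⁻¹ • (x : X), K.smul_mem x.2 (inv_pos.2 hn).le⟩ : K) : X)‖ = 1
      simp [norm_smul, hn.ne'], rfl⟩
    rw [h, norm_smul, norm_inv, norm_norm, inv_mul_le_iff₀ hn] at h1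
    rw [mul_comm]
    exact h1

theorem Homogeneous.iterate {f : K → K} (hf : Homogeneous f) (n : ℕ) : Homogeneous (f^[n]) := by
  induction n with
  | zero => intro c hc x; rfl
  | succ n ih =>
    intro c hc x
    have h := hf c hc (f^[n] x)
    have e : f^[n] ⟨c • (x : X), K.smul_mem x.2 hc.le⟩
        = ⟨c • (f^[n] x : X), K.smul_mem (f^[n] x).2 hc.le⟩ := Subtype.ext (ih c hc x)
    rw [Function.iterate_succ_apply', Function.iterate_succ_apply', e, h]

/-- For a bounded homogeneous map, `coneSpectralRadius f` is the limit of `‖f ^ n‖ ^ (1 / n)`. -/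
theorem tendsto_coneSpectralRadius {f : K → K} (hf : Homogeneous f)
    (hb : BddAbove {t : ℝ | ∃ x : K, ‖(x : X)‖ = 1 ∧ t = ‖(f x : X)‖}) :
    Tendsto (fun n : ℕ => coneNorm (f^[n]) ^ (1 / (n : ℝ))) atTop (𝓝 (coneSpectralRadius f)) := by
  have hbn : ∀ n, ∀ x : K, ‖(f^[n] x : X)‖ ≤ coneNorm f ^ n * ‖(x : X)‖ := by
    intro n
    induction n with
    | zero => simp
    | succ n ih =>
      intro x
      rw [Function.iterate_succ_apply', pow_succ', mul_assoc]
      exact (norm_le_coneNorm hf hb _).trans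
        (mul_le_mul_of_nonneg_left (ih x) (coneNorm_nonneg f))
  have hbd : ∀ n, BddAbove {t : ℝ | ∃ x : K, ‖(x : X)‖ = 1 ∧ t = ‖(f^[n] x : X)‖} := by
    intro n
    refine ⟨coneNorm f ^ n, ?_⟩
    rintro t ⟨x, hx, rfl⟩
    simpa [hx] using hbn n x
  refine fekete_mul (fun n => coneNorm (f^[n])) (fun n => coneNorm_nonneg _) (fun m n => ?_)
  refine Real.sSup_le ?_ (mul_nonneg (coneNorm_nonneg _) (coneNorm_nonneg _))
  rintro t ⟨x, hx, rfl⟩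
  rw [Function.iterate_add_apply]
  refine (norm_le_coneNorm (hf.iterate m) (hbd m) _).trans
    (mul_le_mul_of_nonneg_left ?_ (coneNorm_nonneg _))
  simpa [hx] using norm_le_coneNorm (hf.iterate n) (hbd n) x

end ConeMaps

end

noncomputable section

namespace ConeMaps

variable {X : Type*} [NormedAddCommGroup X] [NormedSpace ℝ X]
variable {K : ProperCone ℝ X}

/-! Let ρ(B) be the infimum of the rates θ for which products of n members of B have norm O(θ^n). It
is enough to prove r(A_k) → ρ(B): the constant sequence B then gives r(B) = ρ(B).

Upper bound: for n large, the norm bound on B^n is a strict inequality on the compact unit sphere of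
K. It therefore passes to A_k^n for large k, and submultiplicativity extends it to all lengths.

Lower bound: for 0 < μ < ρ(B) it suffices to find f ∈ B^n and x ≠ 0 in K with f(x) ≥ μ^n x. Such an
inequality forces r(f) ≥ μ^n by iteration. On a polyhedral cone it also survives a perturbation of f
at the cost of a factor close to 1, because points of K near p dominate a p for each a < 1
(`exists_forall_sub_smul_mem`).

The vector x comes from trajectories of B (`exists_expanding_of_hasGrowth`). Zorn's lemma gives a
minimal closed conic set Z ⊆ K in which trajectories grow at every rate below some τ in (μ, ρ(B)).
Finite generation of K gives p ∈ Z and an open conic neighbourhood V of p such that points of Z ∩ V,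
normalized by a positive functional φ, lie between p/2 and C p. By minimality, trajectories in Z \ V
grow at most at some rate θ < τ. If returns from V to V did too, so would all trajectories in Z, a
contradiction. A return that grows faster, compared by monotonicity with multiples of p, yields x.
-/

/-! ### Positive functionals and generators of the cone -/

theorem exists_bounded_below_functional [FiniteDimensional ℝ X]
    (hK : (K : Set X) ∩ -(K : Set X) = {0}) :
    ∃ (φ : StrongDual ℝ X) (c : ℝ), 0 < c ∧ ∀ x ∈ K, c * ‖x‖ ≤ φ x := by
  have : ProperSpace X := FiniteDimensional.proper_real X
  have hS : IsCompact ((K : Set X) ∩ Metric.sphere 0 1) :=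
    (isCompact_sphere (0 : X) 1).inter_left K.isClosed
  have hsep : ∀ x : X, ∃ f : StrongDual ℝ X, (∀ y ∈ K, 0 ≤ f y) ∧ (x ∈ K → x ≠ 0 → 0 < f x) := by
    intro x
    -- A functional separating -x from K is positive at x; if -x ∈ K, then x ∈ K forces x = 0
    -- because K is pointed.
    by_cases hx : -x ∈ K
    · refine ⟨0, fun _ _ => le_rfl, fun hxK hx0 => absurd ?_ hx0⟩
      have : x ∈ (K : Set X) ∩ -(K : Set X) := ⟨hxK, hx⟩
      rw [hK] at this
      exact this
    · obtain ⟨f, hf, hfx⟩ := K.hyperplane_separation_point hx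
      exact ⟨f, hf, fun _ _ => by simpa using hfx⟩
  choose f hf0 hf using hsep
  obtain ⟨t, ht⟩ := hS.elim_finite_subcover (fun x : X => {y | 0 < f x y})
    (fun x => isOpen_lt continuous_const (f x).continuous) (fun x hx => by
      refine mem_iUnion.2 ⟨x, hf x hx.1 ?_⟩
      rintro rfl
      simpa using hx.2)
  set φ : StrongDual ℝ X := ∑ x ∈ t, f x with hφ
  have hpos : ∀ y ∈ (K : Set X) ∩ Metric.sphere 0 1, 0 < φ y := by
    intro y hy
    obtain ⟨x, hx, hxy⟩ := mem_iUnion₂.1 (ht hy)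
    rw [hφ, sum_apply]
    exact Finset.sum_pos' (fun x _ => hf0 x y hy.1) ⟨x, hx, hxy⟩
  obtain ⟨c, hc, hcy⟩ : ∃ c : ℝ, 0 < c ∧ ∀ y ∈ (K : Set X) ∩ Metric.sphere 0 1, c ≤ φ y := by
    rcases ((K : Set X) ∩ Metric.sphere 0 1).eq_empty_or_nonempty with h | h
    · exact ⟨1, one_pos, by simp [h]⟩
    · obtain ⟨z, hz, hmin⟩ := hS.exists_isMinOn h φ.continuous.continuousOn
      exact ⟨φ z, hpos z hz, fun y hy => hmin hy⟩
  refine ⟨φ, c, hc, fun x hx => ?_⟩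
  rcases eq_or_ne x 0 with rfl | h0
  · simp
  · have hn : 0 < ‖x‖ := norm_pos_iff.2 h0
    have := hcy (‖x‖⁻¹ • x) ⟨K.smul_mem hx (inv_pos.2 hn).le, by simp [norm_smul, hn.ne']⟩
    rw [map_smul, smul_eq_mul, ← div_eq_inv_mul, le_div_iff₀ hn] at this
    exact this

section Functional

variable {φ : StrongDual ℝ X} {c : ℝ}

theorem functional_nonneg (hc : 0 < c) (hφ : ∀ x ∈ K, c * ‖x‖ ≤ φ x) {x : X} (hx : x ∈ K) :
    0 ≤ φ x :=
  (mul_nonneg hc.le (norm_nonneg x)).trans (hφ x hx)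

theorem functional_pos (hc : 0 < c) (hφ : ∀ x ∈ K, c * ‖x‖ ≤ φ x) {x : X} (hx : x ∈ K)
    (h0 : x ≠ 0) : 0 < φ x :=
  (mul_pos hc (norm_pos_iff.2 h0)).trans_le (hφ x hx)

/-- Rescaling the endpoints of a segment that meets the ray to φ = 1 gives a segment through e,
whose endpoints equal e by extremality. -/
theorem isExtremeRay_of_mem_extremePoints (hc : 0 < c) (hφ : ∀ x ∈ K, c * ‖x‖ ≤ φ x) {e : X}
    (he : e ∈ ((K : Set X) ∩ {x | φ x = 1}).extremePoints ℝ) :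
    IsExtremeRay K {y | ∃ a : ℝ, 0 ≤ a ∧ y = a • e} := by
  obtain ⟨⟨heK, he1⟩, hext⟩ := he
  have he1 : φ e = 1 := he1
  have hnormalize : ∀ x ∈ K, 0 < φ x → (φ x)⁻¹ • x ∈ (K : Set X) ∩ {x | φ x = 1} := fun x hx h =>
    ⟨K.smul_mem hx (inv_pos.2 h).le, by simp [h.ne']⟩
  refine ⟨⟨e, ?_, rfl⟩, ?_, ?_⟩
  · rintro rfl
    simp at he1
  · rintro _ ⟨a, ha, rfl⟩
    exact K.smul_mem heK ha
  · rintro x hx y hy _ ⟨d, hd, rfl⟩ ⟨a, b, ha, hb, -, hab⟩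
    have hsum : a * φ x + b * φ y = d := by
      have := congrArg φ hab
      simpa [he1] using this
    have hx0 := functional_nonneg hc hφ hx
    have hy0 := functional_nonneg hc hφ hy
    rcases eq_or_ne x 0 with rfl | hxn
    · exact ⟨0, le_rfl, by simp⟩
    have hxp := functional_pos hc hφ hx hxn
    have hdp : 0 < d := by
      have := mul_pos ha hxp
      have := mul_nonneg hb.le hy0
      linarith
    rcases eq_or_ne y 0 with rfl | hyn
    · refine ⟨a⁻¹ * d, by positivity, ?_⟩
      rw [smul_zero, add_zero] at hab
      rw [mul_smul, ← hab, inv_smul_smul₀ ha.ne']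
    have hyp := functional_pos hc hφ hy hyn
    have hxe : (φ x)⁻¹ • x = e := by
      refine hext (hnormalize x hx hxp) (hnormalize y hy hyp)
        ⟨a * φ x / d, b * φ y / d, by positivity, by positivity, ?_, ?_⟩
      · rw [← add_div, hsum, div_self hdp.ne']
      · rw [smul_smul, smul_smul, div_mul_eq_mul_div, div_mul_eq_mul_div,
          mul_assoc, mul_assoc, mul_inv_cancel₀ hxp.ne', mul_inv_cancel₀ hyp.ne', mul_one, mul_one,
          div_eq_inv_mul, div_eq_inv_mul, mul_smul, mul_smul, ← smul_add, hab,
          inv_smul_smul₀ hdp.ne']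
    exact ⟨φ x, hx0, by rw [← hxe, smul_inv_smul₀ hxp.ne']⟩

/-- The base φ = 1 is compact and convex, and its extreme points inject into the extreme rays, so
they are finitely many. By Krein–Milman they span the base; the convex hull of a finite set is
already closed. -/
theorem exists_finset_generators [FiniteDimensional ℝ X] (hfin : {R : Set X | IsExtremeRay K R}.Finite)
    (hc : 0 < c) (hφ : ∀ x ∈ K, c * ‖x‖ ≤ φ x) :
    ∃ s : Finset X, (∀ v ∈ s, v ∈ K ∧ φ v = 1) ∧
      ∀ x ∈ K, ∃ w : X → ℝ, (∀ v ∈ s, 0 ≤ w v) ∧ x = ∑ v ∈ s, w v • v := by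
  have : ProperSpace X := FiniteDimensional.proper_real X
  set D : Set X := (K : Set X) ∩ {x | φ x = 1} with hD
  have hDconv : Convex ℝ D := K.convex.inter
    (convex_hyperplane (f := fun x => φ x) φ.toLinearMap.isLinear 1)
  have hDcomp : IsCompact D := by
    refine Metric.isCompact_of_isClosed_isBounded
      (K.isClosed.inter (isClosed_eq φ.continuous continuous_const)) ?_
    refine (Metric.isBounded_closedBall (x := (0 : X)) (r := c⁻¹)).subset ?_
    rintro x ⟨hxK, hx1⟩
    have h := hφ x hxK
    rw [show φ x = 1 from hx1] at h
    rw [mem_closedBall_zero_iff, ← one_div, le_div_iff₀ hc, mul_comm]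
    exact h
  have hE : (D.extremePoints ℝ).Finite := by
    refine Set.Finite.of_injOn (f := fun e => {y : X | ∃ a : ℝ, 0 ≤ a ∧ y = a • e})
      (fun e he => isExtremeRay_of_mem_extremePoints hc hφ he) ?_ hfin
    intro e he e' he' h
    have : e ∈ {y : X | ∃ a : ℝ, 0 ≤ a ∧ y = a • e'} := by
      refine h.subset ?_
      exact ⟨1, zero_le_one, (one_smul _ _).symm⟩
    obtain ⟨a, -, ha⟩ := this
    have h1 : φ e = 1 := he.1.2
    have h2 : φ e' = 1 := he'.1.2
    have h3 : a = 1 := by simpa [h1, h2] using (congrArg φ ha).symm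
    rw [ha, h3, one_smul]
  have hhull : convexHull ℝ (D.extremePoints ℝ) = D := by
    have h := closure_convexHull_extremePoints hDcomp hDconv
    rwa [(hE.isCompact_convexHull ℝ).isClosed.closure_eq] at h
  refine ⟨hE.toFinset, fun v hv => ?_, fun x hx => ?_⟩
  · have := ((Set.Finite.mem_toFinset _).1 hv).1
    exact this
  · rcases eq_or_ne x 0 with rfl | h0
    · exact ⟨0, by simp, by simp⟩
    have hp := functional_pos hc hφ hx h0
    have hxD : (φ x)⁻¹ • x ∈ convexHull ℝ (hE.toFinset : Set X) := by
      rw [hE.coe_toFinset, hhull]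
      exact ⟨K.smul_mem hx (inv_pos.2 hp).le, by simp [hp.ne']⟩
    obtain ⟨w, hw0, -, hw⟩ := Finset.mem_convexHull'.1 hxD
    refine ⟨fun v => φ x * w v, fun v hv => mul_nonneg hp.le (hw0 v hv), ?_⟩
    simp_rw [mul_smul, ← Finset.smul_sum, hw, smul_inv_smul₀ hp.ne']

/-- Lower semicontinuity of the cone order: a point of `K` near `p` dominates `a • p`, `a < 1`. -/
theorem exists_forall_sub_smul_mem {s : Finset X}
    (hs : ∀ v ∈ s, v ∈ K ∧ φ v = 1)
    (hgen : ∀ x ∈ K, ∃ w : X → ℝ, (∀ v ∈ s, 0 ≤ w v) ∧ x = ∑ v ∈ s, w v • v)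
    (p : X) {a : ℝ} (ha : a < 1) :
    ∃ δ > 0, ∀ q ∈ K, ‖q - p‖ < δ → q - a • p ∈ K := by
  by_contra! hcon
  choose q hqK hqd hq using fun j : ℕ => hcon (1 / ((j : ℝ) + 1)) (by positivity)
  have hqp : Tendsto q atTop (𝓝 p) := by
    rw [tendsto_iff_norm_sub_tendsto_zero]
    exact squeeze_zero (fun _ => norm_nonneg _) (fun j => (hqd j).le)
      tendsto_one_div_add_atTop_nhds_zero_nat
  choose w hw0 hw using fun j => hgen (q j) (hqK j)
  have hwle : ∀ j, ∀ v ∈ s, w j v ≤ φ (q j) := by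
    intro j v hv
    have : φ (q j) = ∑ v ∈ s, w j v := by
      conv_lhs => rw [hw j]
      rw [map_sum]
      exact Finset.sum_congr rfl fun v hv => by simp [(hs v hv).2]
    rw [this]
    exact Finset.single_le_sum (fun v hv => hw0 j v hv) hv
  obtain ⟨M, hM⟩ := ((φ.continuous.tendsto p).comp hqp).bddAbove_range
  -- The weights of q j are bounded, so they converge along a subsequence to weights d representing
  -- the limit p.
  obtain ⟨d, -, ψ, hψ, hd⟩ := (isCompact_univ_pi (fun _ : s => isCompact_Icc (a := (0 : ℝ)) (b := M))).tendsto_subseq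
    (x := fun j (v : s) => w j v) (fun j v _ => ⟨hw0 j v v.2,
      (hwle j v v.2).trans (hM (mem_range_self j))⟩)
  rw [tendsto_pi_nhds] at hd
  have hd0 : ∀ v : s, 0 ≤ d v := fun v =>
    ge_of_tendsto' (hd v) fun j => hw0 _ v v.2
  have hqsum : ∀ j, q j = ∑ v : s, w j v • (v : X) := fun j => by
    rw [Finset.sum_coe_sort s (fun v => w j v • v)]
    exact hw j
  have hp : p = ∑ v : s, d v • (v : X) := by
    refine tendsto_nhds_unique (hqp.comp hψ.tendsto_atTop) ?_
    simp_rw [Function.comp_def, hqsum]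
    exact tendsto_finsetSum _ fun v _ => (hd v).smul_const _
  -- Finitely many weights: a positive limit eventually exceeds a times itself, and a zero limit
  -- asks only for nonnegativity.
  have hev : ∀ v : s, ∀ᶠ j in atTop, a * d v ≤ w (ψ j) v := by
    intro v
    rcases (hd0 v).eq_or_lt with h | h
    · rw [← h, mul_zero]
      exact Eventually.of_forall fun j => hw0 _ v v.2
    · exact (hd v).eventually_const_le (by nlinarith)
  obtain ⟨j, hj⟩ := (eventually_all.2 hev).exists
  refine hq (ψ j) ?_
  rw [hqsum, hp, Finset.smul_sum, ← Finset.sum_sub_distrib]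
  refine K.sum_mem fun v _ => ?_
  rw [smul_smul, ← sub_smul]
  exact K.smul_mem (hs v v.2).1 (sub_nonneg.2 (hj v))

end Functional

/-! ### Products of members of a family and their trajectories -/

theorem familyPow_add {A : Set (K → K)} {m n : ℕ} {f g : K → K} (hf : f ∈ familyPow A m)
    (hg : g ∈ familyPow A n) : f ∘ g ∈ familyPow A (m + n) := by
  induction m generalizing f with
  | zero =>
    obtain rfl : f = id := hf
    rwa [Nat.zero_add]
  | succ m ih =>
    obtain ⟨h, hh, k, hk, rfl⟩ := hf
    rw [Nat.add_right_comm]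
    exact ⟨h, hh, k ∘ g, ih hk, rfl⟩

theorem iterate_mem_familyPow {A : Set (K → K)} {n : ℕ} {f : K → K} (hf : f ∈ familyPow A n)
    (j : ℕ) : f^[j] ∈ familyPow A (j * n) := by
  induction j with
  | zero => rw [Nat.zero_mul]; rfl
  | succ j ih =>
    rw [Function.iterate_succ', Nat.succ_mul, Nat.add_comm]
    exact familyPow_add hf ih

theorem orderPreserving_of_mem_familyPow {A : Set (K → K)} (hA : ∀ f ∈ A, OrderPreserving f)
    {n : ℕ} {f : K → K} (hf : f ∈ familyPow A n) : OrderPreserving f := by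
  induction n generalizing f with
  | zero =>
    obtain rfl : f = id := hf
    exact fun x y h => h
  | succ n ih =>
    obtain ⟨h, hh, k, hk, rfl⟩ := hf
    exact fun x y hxy => hA h hh _ _ (ih hk x y hxy)

theorem homogeneous_of_mem_familyPow {A : Set (K → K)} (hA : ∀ f ∈ A, Homogeneous f)
    {n : ℕ} {f : K → K} (hf : f ∈ familyPow A n) : Homogeneous f := by
  induction n generalizing f with
  | zero =>
    obtain rfl : f = id := hf
    exact fun c hc x => rfl
  | succ n ih =>
    obtain ⟨h, hh, k, hk, rfl⟩ := hf
    intro c hc x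
    have e : k ⟨c • (x : X), K.smul_mem x.2 hc.le⟩ = ⟨c • (k x : X), K.smul_mem (k x).2 hc.le⟩ :=
      Subtype.ext (ih hk c hc x)
    rw [Function.comp_apply, e, hA h hh c hc (k x), Function.comp_apply]

/-- Some member of `A` sends `x` to `y`. -/
def Step (A : Set (K → K)) (x y : X) : Prop :=
  ∃ f ∈ A, ∃ x' : K, (x' : X) = x ∧ (f x' : X) = y

/-- `z 0, …, z n` is a trajectory of `A` that stays in `Z`. -/
def IsPath (A : Set (K → K)) (Z : Set X) (n : ℕ) (z : ℕ → X) : Prop :=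
  (∀ i ≤ n, z i ∈ Z) ∧ ∀ i < n, Step A (z i) (z (i + 1))

/-- The trajectories of `A` in `Z` can grow at every exponential rate less than `τ`, when measured
by `φ`. -/
def HasGrowth (A : Set (K → K)) (φ : StrongDual ℝ X) (τ : ℝ) (Z : Set X) : Prop :=
  ∀ n, 1 ≤ n → ∀ θ, 0 < θ → θ < τ → ∃ z, IsPath A Z n z ∧ φ (z 0) = 1 ∧ θ ^ n ≤ φ (z n)

theorem IsPath.mono {A : Set (K → K)} {Z Z' : Set X} {n : ℕ} {z : ℕ → X} (h : IsPath A Z n z)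
    (hZ : Z ⊆ Z') : IsPath A Z' n z :=
  ⟨fun i hi => hZ (h.1 i hi), h.2⟩

theorem IsPath.of_le {A : Set (K → K)} {Z : Set X} {m n : ℕ} {z : ℕ → X} (h : IsPath A Z n z)
    (hmn : m ≤ n) : IsPath A Z m z :=
  ⟨fun i hi => h.1 i (hi.trans hmn), fun i hi => h.2 i (hi.trans_le hmn)⟩

theorem IsPath.shift {A : Set (K → K)} {Z : Set X} {m n : ℕ} {z : ℕ → X}
    (h : IsPath A Z (m + n) z) : IsPath A Z n (fun i => z (m + i)) :=
  ⟨fun i hi => h.1 _ (by omega), fun i hi => h.2 (m + i) (by omega)⟩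

theorem IsPath.exists_mem_familyPow {A : Set (K → K)} {Z : Set X} {n : ℕ} {z : ℕ → X}
    (h : IsPath A Z n z) (h0 : z 0 ∈ K) :
    ∃ f ∈ familyPow A n, (f ⟨z 0, h0⟩ : X) = z n := by
  induction n with
  | zero => exact ⟨id, rfl, rfl⟩
  | succ n ih =>
    obtain ⟨g, hg, hgz⟩ := ih (h.of_le n.le_succ)
    obtain ⟨f, hf, x', hx', hfx⟩ := h.2 n n.lt_succ_self
    refine ⟨f ∘ g, ⟨f, hf, g, hg, rfl⟩, ?_⟩
    rw [← hfx, Function.comp_apply]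
    congr 2
    exact Subtype.ext (hgz.trans hx'.symm)

theorem exists_isPath {A : Set (K → K)} {n : ℕ} {f : K → K} (hf : f ∈ familyPow A n) (x : K) :
    ∃ z, IsPath A K n z ∧ z 0 = x ∧ z n = f x := by
  induction n generalizing f with
  | zero =>
    obtain rfl : f = id := hf
    exact ⟨fun _ => x, ⟨fun _ _ => x.2, by simp⟩, rfl, rfl⟩
  | succ n ih =>
    obtain ⟨h, hh, k, hk, rfl⟩ := hf
    obtain ⟨z, hz, hz0, hzn⟩ := ih hk
    refine ⟨fun i => if i ≤ n then z i else h (k x), ⟨fun i hi => ?_, fun i hi => ?_⟩, ?_, ?_⟩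
    · dsimp only
      split_ifs with hin
      · exact hz.1 i hin
      · exact (h (k x)).2
    · rcases (Nat.lt_succ_iff.1 hi).lt_or_eq with hlt | rfl
      · simpa only [hlt.le, Nat.succ_le_of_lt hlt, if_true] using hz.2 i hlt
      · simp only [le_refl, if_true, Nat.not_succ_le_self, if_false]
        exact ⟨h, hh, k x, hzn.symm, rfl⟩
    · simpa using hz0
    · simp

theorem IsPath.smul {A : Set (K → K)} (hA : ∀ f ∈ A, Homogeneous f) {Z : Set X}
    (hZ : ∀ a : ℝ, 0 < a → ∀ x ∈ Z, a • x ∈ Z) {n : ℕ} {z : ℕ → X} (h : IsPath A Z n z) {a : ℝ}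
    (ha : 0 < a) : IsPath A Z n (fun i => a • z i) := by
  refine ⟨fun i hi => hZ a ha _ (h.1 i hi), fun i hi => ?_⟩
  obtain ⟨f, hf, x', hx', hfx⟩ := h.2 i hi
  refine ⟨f, hf, ⟨a • (x' : X), K.smul_mem x'.2 ha.le⟩, ?_, ?_⟩
  · simp [hx']
  · rw [hA f hf a ha x', hfx]

/-! ### Growth of trajectories -/

section Growth

variable {φ : StrongDual ℝ X} {c M : ℝ} {A : Set (K → K)} {Z : Set X}

theorem IsPath.le_mul_pow (hM0 : 0 ≤ M) (hM : ∀ f ∈ A, ∀ x : K, φ (f x) ≤ M * φ x)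
    {n : ℕ} {z : ℕ → X} (h : IsPath A Z n z) : φ (z n) ≤ M ^ n * φ (z 0) := by
  induction n with
  | zero => simp
  | succ n ih =>
    obtain ⟨f, hf, x', hx', hfx⟩ := h.2 n n.lt_succ_self
    rw [← hfx, pow_succ', mul_assoc]
    refine (hM f hf x').trans (mul_le_mul_of_nonneg_left ?_ hM0)
    rw [hx']
    exact ih (h.of_le n.le_succ)

/-- Blocks of length m are split off one at a time; the last piece, of length at most m, costs at
most (M / θ) ^ m. -/
theorem growth_bound_of_length (hZ : ∀ x ∈ Z, 0 ≤ φ x) (hM0 : 0 ≤ M)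
    (hM : ∀ f ∈ A, ∀ x : K, φ (f x) ≤ M * φ x) {θ : ℝ} (hθ : 0 < θ) (hθM : θ ≤ M) {m : ℕ}
    (hm : 1 ≤ m) (key : ∀ z, IsPath A Z m z → φ (z m) ≤ θ ^ m * φ (z 0)) (n : ℕ) (z : ℕ → X)
    (hz : IsPath A Z n z) : φ (z n) ≤ (M / θ) ^ m * θ ^ n * φ (z 0) := by
  have hMθ : 1 ≤ M / θ := (one_le_div hθ).2 hθM
  induction n using Nat.strong_induction_on generalizing z with
  | _ n ih =>
    have hz0 : 0 ≤ φ (z 0) := hZ _ (hz.1 0 (Nat.zero_le _))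
    rcases le_or_gt n m with hnm | hmn
    · refine (hz.le_mul_pow hM0 hM).trans (mul_le_mul_of_nonneg_right ?_ hz0)
      have : M ^ n = (M / θ) ^ n * θ ^ n := by rw [← mul_pow, div_mul_cancel₀ _ hθ.ne']
      rw [this]
      exact mul_le_mul_of_nonneg_right (pow_le_pow_right₀ hMθ hnm) (by positivity)
    · obtain ⟨k, rfl⟩ := Nat.exists_eq_add_of_lt hmn
      rw [Nat.add_assoc] at hz ⊢
      have h1 := ih (k + 1) (by omega) _ hz.shift
      have h2 := key z (hz.of_le (Nat.le_add_right _ _))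
      calc φ (z (m + (k + 1))) ≤ (M / θ) ^ m * θ ^ (k + 1) * φ (z m) := h1
        _ ≤ (M / θ) ^ m * θ ^ (k + 1) * (θ ^ m * φ (z 0)) :=
          mul_le_mul_of_nonneg_left h2 (by positivity)
        _ = _ := by ring

/-- Failure of growth is a bound at a single length m, valid for all starting points by homogeneity
and for all lengths by splitting into blocks. -/
theorem exists_growth_bound (hc : 0 < c) (hφ : ∀ x ∈ K, c * ‖x‖ ≤ φ x)
    (hA : ∀ f ∈ A, Homogeneous f) (hM0 : 0 ≤ M) (hM : ∀ f ∈ A, ∀ x : K, φ (f x) ≤ M * φ x)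
    (hZK : Z ⊆ K) (hZ : ∀ a : ℝ, 0 < a → ∀ x ∈ Z, a • x ∈ Z) {τ μ : ℝ} (hτ : τ ≤ M)
    (hμ : μ < τ) (h : ¬ HasGrowth A φ τ Z) :
    ∃ θ D : ℝ, 0 < θ ∧ μ ≤ θ ∧ θ < τ ∧ 1 ≤ D ∧
      ∀ n z, IsPath A Z n z → φ (z n) ≤ D * θ ^ n * φ (z 0) := by
  simp only [HasGrowth, not_forall, not_exists, not_and, not_le] at h
  obtain ⟨m, hm, θ₀, hθ₀, hθ₀τ, h⟩ := h
  -- Raising the rate to at least μ allows the later comparison of μ ^ n with θ ^ n.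
  set θ := max θ₀ μ with hθdef
  have hθ : 0 < θ := lt_max_of_lt_left hθ₀
  have hθτ : θ < τ := max_lt hθ₀τ hμ
  have key : ∀ z, IsPath A Z m z → φ (z m) ≤ θ ^ m * φ (z 0) := by
    intro z hz
    have hz0 : z 0 ∈ K := hZK (hz.1 0 (Nat.zero_le _))
    rcases eq_or_ne (z 0) 0 with h0 | h0
    · have := hz.le_mul_pow hM0 hM
      rwa [h0, map_zero, mul_zero] at this ⊢
    · have hp := functional_pos hc hφ hz0 h0
      have h1 := (h _ (hz.smul hA hZ (inv_pos.2 hp)) (by simp [hp.ne'])).le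
      rw [map_smul, smul_eq_mul, inv_mul_le_iff₀ hp, mul_comm] at h1
      exact h1.trans (mul_le_mul_of_nonneg_right
        (pow_le_pow_left₀ hθ₀.le (le_max_left _ _) m) hp.le)
  exact ⟨θ, (M / θ) ^ m, hθ, le_max_right _ _, hθτ,
    one_le_pow₀ ((one_le_div hθ).2 (hθτ.le.trans hτ)),
    growth_bound_of_length (fun x hx => functional_nonneg hc hφ (hZK hx)) hM0 hM hθ
      (hθτ.le.trans hτ) hm key⟩

/-- For fixed n and θ, the normalized trajectories in the members of the chain form nested nonempty
compact sets, hence have a common element. -/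
theorem hasGrowth_sInter [FiniteDimensional ℝ X] (hc : 0 < c) (hφ : ∀ x ∈ K, c * ‖x‖ ≤ φ x)
    (hM1 : 1 ≤ M) (hM : ∀ f ∈ A, ∀ x : K, φ (f x) ≤ M * φ x)
    (hcl : IsClosed {p : X × X | Step A p.1 p.2}) {τ : ℝ} {S : Set (Set X)} (hS : S.Nonempty)
    (hchain : IsChain (· ⊆ ·) S) (hSK : ∀ Z ∈ S, Z ⊆ K) (hSc : ∀ Z ∈ S, IsClosed Z)
    (hSg : ∀ Z ∈ S, HasGrowth A φ τ Z) : HasGrowth A φ τ (⋂₀ S) := by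
  have : ProperSpace X := FiniteDimensional.proper_real X
  intro n hn θ hθ hθτ
  set T : Set X → Set (ℕ → X) := fun Z => {z | IsPath A Z n z ∧ φ (z 0) = 1 ∧ θ ^ n ≤ φ (z n) ∧
    ∀ i, z i ∈ Metric.closedBall (0 : X) (c⁻¹ * M ^ n)} with hT
  have hTcl : ∀ Z ∈ S, IsClosed (T Z) := by
    intro Z hZ
    have e : T Z = (⋂ i ∈ Iic n, (fun z : ℕ → X => z i) ⁻¹' Z) ∩
        (⋂ i ∈ Iio n, (fun z : ℕ → X => (z i, z (i + 1))) ⁻¹' {p : X × X | Step A p.1 p.2}) ∩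
        {z | φ (z 0) = 1} ∩ {z | θ ^ n ≤ φ (z n)} ∩
        (⋂ i, (fun z : ℕ → X => z i) ⁻¹' Metric.closedBall (0 : X) (c⁻¹ * M ^ n)) := by
      ext z
      simp only [hT, IsPath, mem_ofPred_eq, mem_inter_iff, mem_iInter, mem_preimage, mem_Iic,
        mem_Iio]
      tauto
    rw [e]
    refine ((((isClosed_biInter fun i _ => (hSc Z hZ).preimage (continuous_apply i)).inter
      (isClosed_biInter fun i _ => hcl.preimage (by fun_prop))).inter ?_).inter ?_).inter
      (isClosed_iInter fun i => Metric.isClosed_closedBall.preimage (continuous_apply i))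
    · exact isClosed_eq (by fun_prop) continuous_const
    · exact isClosed_le continuous_const (by fun_prop)
  have hTcomp : ∀ Z ∈ S, IsCompact (T Z) := fun Z hZ =>
    (isCompact_univ_pi fun _ : ℕ => isCompact_closedBall (0 : X) (c⁻¹ * M ^ n)).of_isClosed_subset
      (hTcl Z hZ) fun z hz i _ => hz.2.2.2 i
  have hTne : ∀ Z ∈ S, (T Z).Nonempty := by
    intro Z hZ
    obtain ⟨z, hz, hz0, hzn⟩ := hSg Z hZ n hn θ hθ hθτ
    -- Freezing the trajectory after time n keeps all its terms in the ball.
    refine ⟨fun i => z (min i n), ⟨fun i hi => hz.1 _ (min_le_right _ _), fun i hi => ?_⟩,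
      by simpa using hz0, by simpa using hzn, fun i => ?_⟩
    · beta_reduce
      rw [min_eq_left hi.le, min_eq_left (Nat.succ_le_of_lt hi)]
      exact hz.2 i hi
    · have hle : min i n ≤ n := min_le_right _ _
      have h1 := (hz.of_le hle).le_mul_pow (zero_le_one.trans hM1) hM
      have h2 := hφ _ (hSK Z hZ (hz.1 _ hle))
      have h3 := pow_le_pow_right₀ hM1 hle
      rw [hz0, mul_one] at h1
      rw [mem_closedBall_zero_iff, ← div_eq_inv_mul, le_div_iff₀ hc, mul_comm]
      exact h2.trans (h1.trans h3)
  have : Nonempty S := hS.coe_sort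
  obtain ⟨z, hz⟩ := IsCompact.nonempty_iInter_of_directed_nonempty_isCompact_isClosed
    (fun Z : S => T Z) (fun Z Z' => by
      rcases hchain.total Z.2 Z'.2 with h | h
      · exact ⟨Z, Subset.rfl, fun z hz => ⟨hz.1.mono h, hz.2⟩⟩
      · exact ⟨Z', fun z hz => ⟨hz.1.mono h, hz.2⟩, Subset.rfl⟩)
    (fun Z => hTne Z Z.2) (fun Z => hTcomp Z Z.2) (fun Z => hTcl Z Z.2)
  rw [mem_iInter] at hz
  obtain ⟨Z₀, hZ₀⟩ := hS
  have h0 := hz ⟨Z₀, hZ₀⟩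
  exact ⟨z, ⟨fun i hi => mem_sInter.2 fun Z hZ => (hz ⟨Z, hZ⟩).1.1 i hi, h0.1.2⟩, h0.2.1, h0.2.2.1⟩

end Growth

/-! ### Minimal conic sets with growth and expanded vectors -/

section Growth

variable {φ : StrongDual ℝ X} {c M : ℝ} {A : Set (K → K)}

/-- A conic set contains a normalized point near which all of its normalized points are uniformly
comparable with that point. -/
theorem exists_comparable_nhds {s : Finset X}
    (hs : ∀ v ∈ s, v ∈ K ∧ φ v = 1)
    (hgen : ∀ x ∈ K, ∃ w : X → ℝ, (∀ v ∈ s, 0 ≤ w v) ∧ x = ∑ v ∈ s, w v • v)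
    {Z : Set X} (hZK : Z ⊆ K) (hZ : ∀ a : ℝ, 0 < a → ∀ x ∈ Z, a • x ∈ Z)
    (hne : ∃ x ∈ Z, φ x = 1) :
    ∃ p ∈ Z, φ p = 1 ∧ ∃ δ > 0, ∃ C : ℝ, 1 ≤ C ∧ ∀ q ∈ Z, ‖q - φ q • p‖ < δ * φ q →
      q - (φ q / 2) • p ∈ K ∧ (C * φ q) • p - q ∈ K := by
  classical
  -- The generators dominated by a multiple of x. There are finitely many possible values, so p can
  -- be chosen with maximal support.
  set supp : X → Finset X := fun x => s.filter fun v => ∃ a : ℝ, 0 < a ∧ x - a • v ∈ K with hsupp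
  obtain ⟨p, ⟨hpZ, hp1⟩, hmax⟩ := Set.Finite.exists_maximalFor' supp {x | x ∈ Z ∧ φ x = 1}
    (s.powerset.finite_toSet.subset (by
      rintro _ ⟨x, -, rfl⟩
      exact Finset.mem_coe.2 (Finset.mem_powerset.2 (Finset.filter_subset _ _)))) hne
  obtain ⟨δ, hδ, hball⟩ := exists_forall_sub_smul_mem hs hgen p (a := 1 / 2) (by norm_num)
  have hd : ∀ v : X, ∃ d : ℝ, 0 ≤ d ∧ (v ∈ supp p → d • p - v ∈ K) := by
    intro v
    by_cases hv : v ∈ supp p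
    · obtain ⟨a, ha, h⟩ := (Finset.mem_filter.1 hv).2
      refine ⟨a⁻¹, (inv_pos.2 ha).le, fun _ => ?_⟩
      have := K.smul_mem h (inv_pos.2 ha).le
      rwa [smul_sub, inv_smul_smul₀ ha.ne'] at this
    · exact ⟨0, le_rfl, fun h => absurd h hv⟩
  choose d hd0 hd using hd
  have hpK := hZK hpZ
  have hnorm : ∀ q ∈ Z, φ q = 1 → ‖q - p‖ < δ →
      q - (1 / 2 : ℝ) • p ∈ K ∧ (1 + ∑ v ∈ s, d v) • p - q ∈ K := by
    intro q hq hq1 hqp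
    have hqK := hZK hq
    have hhalf := hball q hqK hqp
    refine ⟨hhalf, ?_⟩
    have hsub : supp p ⊆ supp q := by
      intro v hv
      obtain ⟨hvs, a, ha, h⟩ := Finset.mem_filter.1 hv
      refine Finset.mem_filter.2 ⟨hvs, a / 2, by positivity, ?_⟩
      have e : q - (a / 2) • v = (q - (1 / 2 : ℝ) • p) + (1 / 2 : ℝ) • (p - a • v) := by
        module
      rw [e]
      exact K.add_mem hhalf (K.smul_mem h (by norm_num))
    -- From q ≥ p / 2 the support can only grow, so maximality makes it equal. Every generator
    -- occurring in q is thus below a multiple of p.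
    have hsub' : supp q ⊆ supp p := hmax ⟨hq, hq1⟩ hsub
    obtain ⟨w, hw0, hw⟩ := hgen q hqK
    have hwsum : ∑ v ∈ s, w v = 1 := by
      rw [← hq1, hw, map_sum]
      exact Finset.sum_congr rfl fun v hv => by simp [(hs v hv).2]
    have hterm : ∀ v ∈ s, d v • p - w v • v ∈ K := by
      intro v hv
      have hw1 : w v ≤ 1 := hwsum ▸ Finset.single_le_sum (fun v hv => hw0 v hv) hv
      rcases (hw0 v hv).eq_or_lt with h | h
      · rw [← h, zero_smul, sub_zero]
        exact K.smul_mem hpK (hd0 v)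
      · have hvq : v ∈ supp q := by
          refine Finset.mem_filter.2 ⟨hv, w v, h, ?_⟩
          have : q - w v • v = ∑ u ∈ s.erase v, w u • u := by
            rw [sub_eq_iff_eq_add, Finset.sum_erase_add _ _ hv]
            exact hw
          rw [this]
          exact K.sum_mem fun u hu => K.smul_mem (hs u (Finset.mem_of_mem_erase hu)).1
            (hw0 u (Finset.mem_of_mem_erase hu))
        have e : d v • p - w v • v = w v • (d v • p - v) + ((1 - w v) * d v) • p := by
          module
        rw [e]
        exact K.add_mem (K.smul_mem (hd v (hsub' hvq)) h.le)
          (K.smul_mem hpK (mul_nonneg (sub_nonneg.2 hw1) (hd0 v)))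
    have e : (1 + ∑ v ∈ s, d v) • p - q = p + ∑ v ∈ s, (d v • p - w v • v) := by
      rw [Finset.sum_sub_distrib, ← hw, ← Finset.sum_smul]
      module
    rw [e]
    exact K.add_mem hpK (K.sum_mem hterm)
  refine ⟨p, hpZ, hp1, δ, hδ, 1 + ∑ v ∈ s, d v,
    le_add_of_nonneg_right (Finset.sum_nonneg fun v _ => hd0 v), fun q hq hqp => ?_⟩
  have hq0 : 0 < φ q := by
    refine pos_of_mul_pos_right ((norm_nonneg _).trans_lt hqp) hδ.le
  have hdist : ‖(φ q)⁻¹ • q - p‖ < δ := by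
    have e : (φ q)⁻¹ • q - p = (φ q)⁻¹ • (q - φ q • p) := by
      rw [smul_sub, inv_smul_smul₀ hq0.ne']
    rw [e, norm_smul, Real.norm_of_nonneg (inv_pos.2 hq0).le, inv_mul_lt_iff₀ hq0, mul_comm]
    exact hqp
  obtain ⟨h1, h2⟩ := hnorm _ (hZ _ (inv_pos.2 hq0) q hq) (by simp [hq0.ne']) hdist
  have h1' := K.smul_mem h1 hq0.le
  have h2' := K.smul_mem h2 hq0.le
  rw [smul_sub, smul_inv_smul₀ hq0.ne', smul_smul] at h1' h2'
  rw [mul_one_div] at h1'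
  rw [mul_comm] at h2'
  exact ⟨h1', h2'⟩

/-- Minimality is used by deleting an open conic piece that meets Z: what remains can no longer have
growth. -/
theorem exists_minimal_hasGrowth [FiniteDimensional ℝ X] (hc : 0 < c)
    (hφ : ∀ x ∈ K, c * ‖x‖ ≤ φ x)
    (hM1 : 1 ≤ M) (hM : ∀ f ∈ A, ∀ x : K, φ (f x) ≤ M * φ x)
    (hcl : IsClosed {p : X × X | Step A p.1 p.2}) {τ : ℝ} (hg : HasGrowth A φ τ K) :
    ∃ Z : Set X, Minimal (fun Z : Set X => IsClosed Z ∧ Z ⊆ K ∧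
      (∀ a : ℝ, 0 < a → ∀ x ∈ Z, a • x ∈ Z) ∧ HasGrowth A φ τ Z) Z := by
  obtain ⟨Z, -, hZ⟩ := zorn_superset_nonempty {Z : Set X | IsClosed Z ∧ Z ⊆ K ∧
      (∀ a : ℝ, 0 < a → ∀ x ∈ Z, a • x ∈ Z) ∧ HasGrowth A φ τ Z} (fun S hS hchain hne => by
    obtain ⟨Z₀, hZ₀⟩ := hne
    refine ⟨⋂₀ S, ⟨isClosed_sInter fun Z hZ => (hS hZ).1,
      (sInter_subset_of_mem hZ₀).trans (hS hZ₀).2.1, fun a ha x hx => mem_sInter.2 fun Z hZ =>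
        (hS hZ).2.2.1 a ha x (mem_sInter.1 hx Z hZ), ?_⟩, fun Z hZ => sInter_subset_of_mem hZ⟩
    exact hasGrowth_sInter hc hφ hM1 hM hcl ⟨Z₀, hZ₀⟩ hchain (fun Z hZ => (hS hZ).2.1)
      (fun Z hZ => (hS hZ).1) fun Z hZ => (hS hZ).2.2.2) K
    ⟨K.isClosed, Subset.rfl, fun a ha x hx => K.smul_mem hx ha.le, hg⟩
  exact ⟨Z, hZ⟩

/-- If trajectories outside `V` and trajectories from `V` to `V` grow at rate at most `θ`, then all
trajectories do. -/
theorem growth_bound_of_returns {Z V : Set X} (hZ : ∀ x ∈ Z, 0 ≤ φ x) (hM0 : 0 ≤ M)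
    (hM : ∀ f ∈ A, ∀ x : K, φ (f x) ≤ M * φ x) {θ D E : ℝ} (hθ : 0 < θ) (hD : 1 ≤ D) (hE : 1 ≤ E)
    (hθM : θ ≤ M)
    (hout : ∀ n z, IsPath A (Z \ V) n z → φ (z n) ≤ D * θ ^ n * φ (z 0))
    (hret : ∀ n, 1 ≤ n → ∀ z, IsPath A Z n z → z 0 ∈ V → z n ∈ V → φ (z n) ≤ E * θ ^ n * φ (z 0))
    (n : ℕ) (z : ℕ → X) (hz : IsPath A Z n z) :
    φ (z n) ≤ (M / θ * D) ^ 2 * E * θ ^ n * φ (z 0) := by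
  classical
  have hMθ : 1 ≤ M / θ := (one_le_div hθ).2 hθM
  have hB : 1 ≤ M / θ * D := one_le_mul_of_one_le_of_one_le hMθ hD
  have hstep : ∀ x y, Step A x y → φ y ≤ M * φ x := by
    rintro _ _ ⟨f, hf, x', rfl, rfl⟩
    exact hM f hf x'
  have hleave : ∀ n z, IsPath A Z n z → z 0 ∈ V →
      φ (z n) ≤ (M / θ * D) * E * θ ^ n * φ (z 0) := by
    intro n z hz h0
    have hz0 := hZ _ (hz.1 0 (Nat.zero_le _))
    -- The last visit to V: up to b the return bound applies, and after one further step, costing M,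
    -- the path stays outside V.
    set b := Nat.findGreatest (fun i => z i ∈ V) n with hb
    have hbn : b ≤ n := Nat.findGreatest_le n
    have hbV : z b ∈ V := Nat.findGreatest_spec (P := fun i => z i ∈ V) (Nat.zero_le n) h0
    have hfirst : φ (z b) ≤ E * θ ^ b * φ (z 0) := by
      rcases Nat.eq_zero_or_pos b with h | h
      · rw [h, pow_zero, mul_one]
        exact le_mul_of_one_le_left hz0 hE
      · exact hret b h z (hz.of_le hbn) h0 hbV
    rcases hbn.eq_or_lt with h | h
    · rw [← h]
      refine hfirst.trans (mul_le_mul_of_nonneg_right ?_ hz0)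
      rw [mul_assoc]
      exact le_mul_of_one_le_left (by positivity) hB
    · obtain ⟨k, hk⟩ := Nat.exists_eq_add_of_lt h
      rw [hk] at hz ⊢
      rw [Nat.add_right_comm] at hz ⊢
      have htail : IsPath A (Z \ V) k (fun i => z (b + 1 + i)) :=
        ⟨fun i hi => ⟨hz.1 _ (by omega), fun hV => by
          have := Nat.le_findGreatest (P := fun i => z i ∈ V) (n := n) (m := b + 1 + i)
            (by omega) hV
          omega⟩, hz.shift.2⟩
      have h1 := hout k _ htail
      have h2 := hstep _ _ (hz.2 b (by omega))
      calc φ (z (b + 1 + k)) ≤ D * θ ^ k * φ (z (b + 1)) := h1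
        _ ≤ D * θ ^ k * (M * (E * θ ^ b * φ (z 0))) :=
          mul_le_mul_of_nonneg_left (h2.trans (mul_le_mul_of_nonneg_left hfirst hM0))
            (by positivity)
        _ = (M / θ * D) * E * θ ^ (b + 1 + k) * φ (z 0) := by
          field_simp
          ring
  have hz0 := hZ _ (hz.1 0 (Nat.zero_le _))
  by_cases hV : ∃ i, i ≤ n ∧ z i ∈ V
  · have hspec := Nat.find_spec hV
    have hmin : ∀ i < Nat.find hV, i ≤ n → z i ∉ V := fun i hi hin h =>
      Nat.find_min hV hi ⟨hin, h⟩
    generalize Nat.find hV = a at hspec hmin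
    obtain ⟨han, haV⟩ := hspec
    obtain ⟨k, rfl⟩ := Nat.exists_eq_add_of_le han
    have h1 := hleave k _ hz.shift haV
    have h2 : φ (z a) ≤ (M / θ * D) * θ ^ a * φ (z 0) := by
      rcases Nat.eq_zero_or_pos a with rfl | ha
      · rw [pow_zero, mul_one]
        exact le_mul_of_one_le_left hz0 hB
      · obtain ⟨j, rfl⟩ := Nat.exists_eq_add_of_lt ha
        rw [Nat.zero_add] at *
        have hpre : IsPath A (Z \ V) j z :=
          ⟨fun i hi => ⟨hz.1 i (by omega), hmin i (by omega) (by omega)⟩,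
            fun i hi => hz.2 i (by omega)⟩
        calc φ (z (j + 1)) ≤ M * φ (z j) := hstep _ _ (hz.2 j (by omega))
          _ ≤ M * (D * θ ^ j * φ (z 0)) := mul_le_mul_of_nonneg_left (hout j z hpre) hM0
          _ = (M / θ * D) * θ ^ (j + 1) * φ (z 0) := by
            field_simp
            ring
    calc φ (z (a + k)) ≤ (M / θ * D) * E * θ ^ k * φ (z a) := h1
      _ ≤ (M / θ * D) * E * θ ^ k * ((M / θ * D) * θ ^ a * φ (z 0)) :=
        mul_le_mul_of_nonneg_left h2 (by positivity)
      _ = _ := by ring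
  · push Not at hV
    refine (hout n z ⟨fun i hi => ⟨hz.1 i hi, hV i hi⟩, hz.2⟩).trans
      (mul_le_mul_of_nonneg_right (mul_le_mul_of_nonneg_right ?_ (by positivity)) hz0)
    calc D ≤ M / θ * D := le_mul_of_one_le_left (by positivity) hMθ
      _ ≤ (M / θ * D) ^ 2 := le_self_pow₀ hB two_ne_zero
      _ ≤ (M / θ * D) ^ 2 * E := le_mul_of_one_le_right (by positivity) hE

theorem exists_expanding_of_hasGrowth [FiniteDimensional ℝ X] (hc : 0 < c)
    (hφ : ∀ x ∈ K, c * ‖x‖ ≤ φ x) {s : Finset X}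
    (hs : ∀ v ∈ s, v ∈ K ∧ φ v = 1)
    (hgen : ∀ x ∈ K, ∃ w : X → ℝ, (∀ v ∈ s, 0 ≤ w v) ∧ x = ∑ v ∈ s, w v • v)
    (hAm : ∀ f ∈ A, OrderPreserving f) (hAh : ∀ f ∈ A, Homogeneous f)
    (hM1 : 1 ≤ M) (hM : ∀ f ∈ A, ∀ x : K, φ (f x) ≤ M * φ x)
    (hcl : IsClosed {p : X × X | Step A p.1 p.2}) {μ τ : ℝ} (hμ0 : 0 ≤ μ) (hμ : μ < τ)
    (hτ : τ ≤ M) (hg : HasGrowth A φ τ K) :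
    ∃ n, 1 ≤ n ∧ ∃ f ∈ familyPow A n, ∃ x : K, (x : X) ≠ 0 ∧ (f x : X) - μ ^ n • (x : X) ∈ K := by
  by_contra hno
  push Not at hno
  have hM0 : 0 ≤ M := zero_le_one.trans hM1
  obtain ⟨Z, ⟨hZcl, hZK, hZ, hZg⟩, hmin⟩ := exists_minimal_hasGrowth hc hφ hM1 hM hcl hg
  have hne : ∃ x ∈ Z, φ x = 1 := by
    obtain ⟨z, hz, hz0, -⟩ := hZg 1 le_rfl ((μ + τ) / 2) (by linarith) (by linarith)
    exact ⟨z 0, hz.1 0 zero_le_one, hz0⟩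
  obtain ⟨p, hpZ, hp1, δ, hδ, C, hC, hcomp⟩ :=
    exists_comparable_nhds hs hgen hZK hZ hne
  have hpK : p ∈ K := hZK hpZ
  have hp0 : p ≠ 0 := by
    rintro rfl
    simp at hp1
  set V : Set X := {x | ‖x - φ x • p‖ < δ * φ x} with hV
  have hVopen : IsOpen V := isOpen_lt (by fun_prop) (by fun_prop)
  have hZV : ∀ a : ℝ, 0 < a → ∀ x ∈ Z \ V, a • x ∈ Z \ V := by
    rintro a ha x ⟨hx, hxV⟩
    refine ⟨hZ a ha x hx, fun h => hxV ?_⟩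
    have e : a • x - φ (a • x) • p = a • (x - φ x • p) := by
      rw [map_smul, smul_eq_mul, smul_sub, smul_smul]
    have h' : ‖a • x - φ (a • x) • p‖ < δ * φ (a • x) := h
    rw [e, norm_smul, Real.norm_of_nonneg ha.le, map_smul, smul_eq_mul, mul_left_comm] at h'
    exact lt_of_mul_lt_mul_left h' ha.le
  have hpV : p ∈ V := by
    change ‖p - φ p • p‖ < δ * φ p
    simpa [hp1] using hδ
  have hnot : ¬ HasGrowth A φ τ (Z \ V) := fun h =>
    (hmin ⟨hZcl.sdiff hVopen, sdiff_subset.trans hZK, hZV, h⟩ sdiff_subset hpZ).2 hpV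
  obtain ⟨θ, D, hθ, hμθ, hθτ, hD, hout⟩ := exists_growth_bound hc hφ hAh hM0 hM
    (sdiff_subset.trans hZK) hZV hτ hμ hnot
  have hret : ∀ n, 1 ≤ n → ∀ z, IsPath A Z n z → z 0 ∈ V → z n ∈ V →
      φ (z n) ≤ (2 * C) * θ ^ n * φ (z 0) := by
    intro n hn z hz h0 hnV
    -- With y = C φ(z 0) p, the chain f(y) ≥ f(z 0) = z n ≥ (φ(z n) / 2) p ≥ θ ^ n y ≥ μ ^ n y
    -- contradicts `hno`.
    by_contra! hlt
    have hzK0 : z 0 ∈ K := hZK (hz.1 0 (Nat.zero_le _))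
    have hzKn : z n ∈ K := hZK (hz.1 n le_rfl)
    have hφ0 : 0 < φ (z 0) :=
      pos_of_mul_pos_right ((norm_nonneg _).trans_lt (show ‖z 0 - φ (z 0) • p‖ < _ from h0)) hδ.le
    obtain ⟨f, hf, hfz⟩ := hz.exists_mem_familyPow hzK0
    have hup := (hcomp _ (hz.1 0 (Nat.zero_le _)) h0).2
    have hlow := (hcomp _ (hz.1 n le_rfl) hnV).1
    have hCp : 0 < C * φ (z 0) := by positivity
    have hmono := orderPreserving_of_mem_familyPow hAm hf ⟨z 0, hzK0⟩
      ⟨(C * φ (z 0)) • p, K.smul_mem hpK hCp.le⟩ hup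
    refine hno n hn f hf ⟨(C * φ (z 0)) • p, K.smul_mem hpK hCp.le⟩ (smul_ne_zero hCp.ne' hp0) ?_
    rw [hfz] at hmono
    have hcoef : 0 ≤ φ (z n) / 2 - μ ^ n * (C * φ (z 0)) := by
      have : μ ^ n * (C * φ (z 0)) ≤ θ ^ n * (C * φ (z 0)) :=
        mul_le_mul_of_nonneg_right (pow_le_pow_left₀ hμ0 hμθ n) hCp.le
      linarith
    have e : (f ⟨(C * φ (z 0)) • p, K.smul_mem hpK hCp.le⟩ : X) - μ ^ n • ((C * φ (z 0)) • p) =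
        (f ⟨(C * φ (z 0)) • p, K.smul_mem hpK hCp.le⟩ - z n) + (z n - (φ (z n) / 2) • p) +
        (φ (z n) / 2 - μ ^ n * (C * φ (z 0))) • p := by
      module
    have := K.add_mem (K.add_mem hmono hlow) (K.smul_mem hpK hcoef)
    rwa [← e] at this
  have hall := growth_bound_of_returns (fun x hx => functional_nonneg hc hφ (hZK hx)) hM0 hM hθ hD
    (by linarith : 1 ≤ 2 * C) (hθτ.le.trans hτ) hout hret
  set B := (M / θ * D) ^ 2 * (2 * C)
  -- Growth in Z at the midpoint rate beats the constant B once n is large; the 1 in the maximum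
  -- forces n ≥ 1.
  have hr : 1 < (θ + τ) / 2 / θ := (one_lt_div hθ).2 (by linarith)
  obtain ⟨n, hn⟩ := pow_unbounded_of_one_lt (max B 1) hr
  have hn1 : 1 ≤ n := by
    rcases Nat.eq_zero_or_pos n with rfl | h
    · simp at hn
    · exact h
  obtain ⟨z, hz, hz0, hzn⟩ := hZg n hn1 ((θ + τ) / 2) (by linarith) (by linarith)
  have h1 := hzn.trans (hall n z hz)
  rw [hz0, mul_one, ← div_le_iff₀ (by positivity), ← div_pow] at h1
  exact absurd (hn.trans_le h1) (not_lt.2 (le_max_left _ _))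

end Growth

/-- The restriction of a continuous map `K → K` to `Ω₁`. -/
def restrictMap (f : K → K) (hf : Continuous f) : C(Omega K 1, X) where
  toFun x := f ⟨x, x.2.1⟩
  continuous_toFun := by fun_prop

theorem restrictMap_mem {A : Set (K → K)} {f : K → K} (hf : f ∈ A) (hfc : Continuous f) :
    restrictMap f hfc ∈ restrictFamily A :=
  ⟨f, hf, fun _ => rfl⟩

/-! ### Compact families and their Hausdorff limits -/

section FiniteDimensional

variable [FiniteDimensional ℝ X]

theorem IsCompactFamily.exists_norm_le {A : Set (K → K)} (hA : IsCompactFamily A) :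
    ∃ M : ℝ, 0 ≤ M ∧ ∀ f ∈ A, ∀ x : K, ‖(f x : X)‖ ≤ M * ‖(x : X)‖ := by
  obtain ⟨M, hM⟩ := hA.isCompact.isBounded.exists_norm_le
  refine ⟨max M 0, le_max_right _ _, fun f hf x => ?_⟩
  rcases eq_or_ne (x : X) 0 with h0 | h0
  · rw [(hA.homogeneous f hf).map_zero x h0, h0, norm_zero, mul_zero]
  have hn : 0 < ‖(x : X)‖ := norm_pos_iff.2 h0
  have h1 := hM _ (restrictMap_mem hf (hA.continuous f hf))
  have h2 := ContinuousMap.norm_coe_le_norm (restrictMap f (hA.continuous f hf))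
    ⟨‖(x : X)‖⁻¹ • (x : X), K.smul_mem x.2 (inv_pos.2 hn).le, by simp [norm_smul, hn.ne']⟩
  have h3 := hA.homogeneous f hf _ (inv_pos.2 hn) x
  simp only [restrictMap, ContinuousMap.coe_mk] at h2
  rw [h3, norm_smul, norm_inv, norm_norm, inv_mul_le_iff₀ hn, mul_comm] at h2
  exact h2.trans (mul_le_mul_of_nonneg_right (h1.trans (le_max_left _ _)) hn.le)

theorem IsCompactFamily.restrictFamily_nonempty {A : Set (K → K)} (hA : IsCompactFamily A) :
    (restrictFamily A).Nonempty := by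
  obtain ⟨f, hf⟩ := hA.nonempty
  exact ⟨_, restrictMap_mem hf (hA.continuous f hf)⟩

/-- The real-valued Hausdorff distance is 0 by default when the extended one is infinite; this
excludes that case. -/
theorem IsCompactFamily.hausdorffEDist_ne_top {A B : Set (K → K)} (hA : IsCompactFamily A)
    (hB : IsCompactFamily B) :
    Metric.hausdorffEDist (restrictFamily A) (restrictFamily B) ≠ ⊤ :=
  Metric.hausdorffEDist_ne_top_of_nonempty_of_bounded hA.restrictFamily_nonempty
    hB.restrictFamily_nonempty hA.isCompact.isBounded hB.isCompact.isBounded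

/-- Uniform convergence of homogeneous maps on `Ω₁` implies continuous convergence on `K`. -/
theorem tendsto_apply_of_tendsto_restrict {g : ℕ → K → K} {f : K → K} (hg : ∀ j, Homogeneous (g j))
    (hf : Homogeneous f) {G : ℕ → C(Omega K 1, X)} {F : C(Omega K 1, X)}
    (hG : ∀ j, ∀ x : Omega K 1, G j x = (g j ⟨x, x.2.1⟩ : X))
    (hF : ∀ x : Omega K 1, F x = (f ⟨x, x.2.1⟩ : X)) (hGF : Tendsto G atTop (𝓝 F))
    {x : ℕ → K} {x₀ : K} (hx : Tendsto x atTop (𝓝 x₀)) :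
    Tendsto (fun j => g j (x j)) atTop (𝓝 (f x₀)) := by
  have hxX : Tendsto (fun j => (x j : X)) atTop (𝓝 (x₀ : X)) :=
    (continuous_subtype_val.tendsto x₀).comp hx
  obtain ⟨R, hR⟩ := hxX.norm.bddAbove_range
  have hR0 : 0 < max R 1 := lt_max_of_lt_right one_pos
  have hxR : ∀ j, ‖(x j : X)‖ ≤ max R 1 := fun j => (hR (mem_range_self j)).trans (le_max_left _ _)
  have hx₀R : ‖(x₀ : X)‖ ≤ max R 1 := le_of_tendsto' hxX.norm hxR
  have hmem : ∀ y : K, ‖(y : X)‖ ≤ max R 1 → (max R 1)⁻¹ • (y : X) ∈ Omega K 1 := fun y hy => by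
    refine ⟨K.smul_mem y.2 (inv_pos.2 hR0).le, ?_⟩
    rw [norm_smul, Real.norm_of_nonneg (inv_pos.2 hR0).le, inv_mul_le_iff₀ hR0, mul_one]
    exact hy
  have hy : Tendsto (fun j => (⟨_, hmem (x j) (hxR j)⟩ : Omega K 1)) atTop
      (𝓝 ⟨_, hmem x₀ hx₀R⟩) := tendsto_subtype_rng.2 (hxX.const_smul _)
  have h1 := hGF.eval hy
  rw [tendsto_subtype_rng]
  have h2 := h1.const_smul (max R 1)
  simp only [hG, hF, hg _ _ (inv_pos.2 hR0), hf _ (inv_pos.2 hR0), smul_inv_smul₀ hR0.ne'] at h2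
  exact h2

section Limits

variable {A : ℕ → Set (K → K)} {B : Set (K → K)}

theorem exists_subseq_tendsto_apply (hA : ∀ k, IsCompactFamily (A k)) (hB : IsCompactFamily B)
    (hAB : Tendsto (fun k => Metric.hausdorffDist (restrictFamily (A k)) (restrictFamily B))
      atTop (𝓝 0)) {g : ℕ → K → K} (hg : ∀ k, g k ∈ A k) {x : ℕ → K} {x₀ : K}
    (hx : Tendsto x atTop (𝓝 x₀)) :
    ∃ f ∈ B, ∃ ψ : ℕ → ℕ, StrictMono ψ ∧
      Tendsto (fun j => g (ψ j) (x (ψ j))) atTop (𝓝 (f x₀)) := by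
  have hgc := fun k => (hA k).continuous _ (hg k)
  -- The slack 1 / (k + 1) supplies the strict inequality needed to select a nearby member.
  choose F hF hFd using fun k => Metric.exists_dist_lt_of_hausdorffDist_lt
    (restrictMap_mem (hg k) (hgc k))
    (lt_add_of_pos_right (Metric.hausdorffDist (restrictFamily (A k)) (restrictFamily B))
      (Nat.one_div_pos_of_nat (n := k) (α := ℝ))) ((hA k).hausdorffEDist_ne_top hB)
  obtain ⟨F₀, ⟨f, hf, hfF⟩, ψ, hψ, hlim⟩ := hB.isCompact.tendsto_subseq hF
  have hd : Tendsto (fun k => dist (F k) (restrictMap (g k) (hgc k))) atTop (𝓝 0) := by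
    refine squeeze_zero (fun _ => dist_nonneg) (fun k => ?_)
      (by simpa only [add_zero] using hAB.add (tendsto_one_div_add_atTop_nhds_zero_nat (𝕜 := ℝ)))
    rw [dist_comm]
    exact (hFd k).le
  refine ⟨f, hf, ψ, hψ, ?_⟩
  exact tendsto_apply_of_tendsto_restrict (fun j => (hA _).homogeneous _ (hg (ψ j)))
    (hB.homogeneous f hf) (G := fun j => restrictMap (g (ψ j)) (hgc (ψ j))) (fun j x => rfl) hfF
    (hlim.congr_dist (hd.comp hψ.tendsto_atTop)) (hx.comp hψ.tendsto_atTop)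

theorem exists_subseq_tendsto_familyPow (hA : ∀ k, IsCompactFamily (A k)) (hB : IsCompactFamily B)
    (hAB : Tendsto (fun k => Metric.hausdorffDist (restrictFamily (A k)) (restrictFamily B))
      atTop (𝓝 0)) {φ : ℕ → ℕ} (hφ : StrictMono φ) {n : ℕ} {g : ℕ → K → K}
    (hg : ∀ j, g j ∈ familyPow (A (φ j)) n) {x : ℕ → K} {x₀ : K}
    (hx : Tendsto x atTop (𝓝 x₀)) :
    ∃ f ∈ familyPow B n, ∃ ψ : ℕ → ℕ, StrictMono ψ ∧
      Tendsto (fun j => g (ψ j) (x (ψ j))) atTop (𝓝 (f x₀)) := by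
  induction n generalizing g with
  | zero =>
    refine ⟨id, rfl, id, strictMono_id, ?_⟩
    have : ∀ j, g j = id := hg
    simpa [this] using hx
  | succ n ih =>
    choose h hh k hk hgk using hg
    obtain ⟨f, hf, ψ, hψ, hlim⟩ := ih hk
    obtain ⟨f', hf', ψ', hψ', hlim'⟩ := exists_subseq_tendsto_apply
      (A := fun j => A (φ (ψ j))) (fun j => hA _) hB
      (hAB.comp (hφ.comp hψ).tendsto_atTop) (fun j => hh (ψ j)) hlim
    refine ⟨f' ∘ f, ⟨f', hf', f, hf, rfl⟩, ψ ∘ ψ', hψ.comp hψ', ?_⟩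
    simpa [hgk] using hlim'

theorem exists_approx (hA : ∀ k, IsCompactFamily (A k)) (hB : IsCompactFamily B)
    (hAB : Tendsto (fun k => Metric.hausdorffDist (restrictFamily (A k)) (restrictFamily B))
      atTop (𝓝 0)) {f : K → K} (hf : f ∈ B) :
    ∃ g : ℕ → K → K, (∀ k, g k ∈ A k) ∧ ∀ (x : ℕ → K) (x₀ : K), Tendsto x atTop (𝓝 x₀) →
      Tendsto (fun k => g k (x k)) atTop (𝓝 (f x₀)) := by
  have hfc := hB.continuous f hf
  choose G hG hGd using fun k => Metric.exists_dist_lt_of_hausdorffDist_lt'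
    (restrictMap_mem hf hfc)
    (lt_add_of_pos_right (Metric.hausdorffDist (restrictFamily (A k)) (restrictFamily B))
      (Nat.one_div_pos_of_nat (n := k) (α := ℝ))) ((hA k).hausdorffEDist_ne_top hB)
  choose g hg hgG using hG
  have hlim : Tendsto G atTop (𝓝 (restrictMap f hfc)) :=
    tendsto_iff_dist_tendsto_zero.2 <| squeeze_zero (fun _ => dist_nonneg) (fun k => (hGd k).le)
      (by simpa only [add_zero] using hAB.add (tendsto_one_div_add_atTop_nhds_zero_nat (𝕜 := ℝ)))
  exact ⟨g, hg, fun x x₀ hx => tendsto_apply_of_tendsto_restrict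
    (fun k => (hA k).homogeneous _ (hg k)) (hB.homogeneous f hf) hgG (fun _ => rfl) hlim hx⟩

theorem exists_approx_familyPow (hA : ∀ k, IsCompactFamily (A k)) (hB : IsCompactFamily B)
    (hAB : Tendsto (fun k => Metric.hausdorffDist (restrictFamily (A k)) (restrictFamily B))
      atTop (𝓝 0)) {n : ℕ} {f : K → K} (hf : f ∈ familyPow B n) :
    ∃ g : ℕ → K → K, (∀ k, g k ∈ familyPow (A k) n) ∧
      ∀ (x : ℕ → K) (x₀ : K), Tendsto x atTop (𝓝 x₀) →
        Tendsto (fun k => g k (x k)) atTop (𝓝 (f x₀)) := by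
  induction n generalizing f with
  | zero =>
    obtain rfl : f = id := hf
    exact ⟨fun _ => id, fun _ => rfl, fun x x₀ hx => hx⟩
  | succ n ih =>
    obtain ⟨h, hh, k, hk, rfl⟩ := hf
    obtain ⟨g, hg, hglim⟩ := ih hk
    obtain ⟨g', hg', hglim'⟩ := exists_approx hA hB hAB hh
    exact ⟨fun j => g' j ∘ g j, fun j => ⟨g' j, hg' j, g j, hg j, rfl⟩,
      fun x x₀ hx => hglim' _ _ (hglim x x₀ hx)⟩

theorem orderPreserving_of_tendsto_hausdorffDist (hA : ∀ k, IsCompactFamily (A k))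
    (hAm : ∀ k, ∀ f ∈ A k, OrderPreserving f) (hB : IsCompactFamily B)
    (hAB : Tendsto (fun k => Metric.hausdorffDist (restrictFamily (A k)) (restrictFamily B))
      atTop (𝓝 0)) {f : K → K} (hf : f ∈ B) : OrderPreserving f := by
  intro x y hxy
  obtain ⟨g, hg, hlim⟩ := exists_approx hA hB hAB hf
  have hx := tendsto_subtype_rng.1 (hlim (fun _ => x) x tendsto_const_nhds)
  have hy := tendsto_subtype_rng.1 (hlim (fun _ => y) y tendsto_const_nhds)
  exact K.isClosed.mem_of_tendsto (hy.sub hx)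
    (Eventually.of_forall fun k => hAm k _ (hg k) x y hxy)

/-- A constant sequence of families has Hausdorff distance 0 to its limit, so the subsequence
argument applies. -/
theorem IsCompactFamily.isClosed_step (hB : IsCompactFamily B) :
    IsClosed {p : X × X | Step B p.1 p.2} := by
  refine IsSeqClosed.isClosed fun p q hp hpq => ?_
  choose f hf x hx hfx using hp
  have hx0 : q.1 ∈ K := K.isClosed.mem_of_tendsto ((continuous_fst.tendsto q).comp hpq)
    (Eventually.of_forall fun j => by
      rw [Function.comp_apply, ← hx j]
      exact (x j).2)
  have hxlim : Tendsto x atTop (𝓝 ⟨q.1, hx0⟩) := by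
    rw [tendsto_subtype_rng]
    simp_rw [hx]
    exact (continuous_fst.tendsto q).comp hpq
  obtain ⟨g, hg, ψ, hψ, hlim⟩ := exists_subseq_tendsto_apply (A := fun _ => B) (fun _ => hB) hB
    (by simp) hf hxlim
  refine ⟨g, hg, ⟨q.1, hx0⟩, rfl, ?_⟩
  rw [tendsto_subtype_rng] at hlim
  refine tendsto_nhds_unique hlim ?_
  simp_rw [hfx]
  exact (continuous_snd.tendsto q).comp (hpq.comp hψ.tendsto_atTop)

end Limits

end FiniteDimensional

/-! ### Estimates for the spectral radii -/

theorem bddAbove_of_norm_le {f : K → K} {C : ℝ} (h : ∀ x : K, ‖(f x : X)‖ ≤ C * ‖(x : X)‖) :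
    BddAbove {t : ℝ | ∃ x : K, ‖(x : X)‖ = 1 ∧ t = ‖(f x : X)‖} := by
  refine ⟨C, ?_⟩
  rintro t ⟨x, hx, rfl⟩
  simpa [hx] using h x

theorem coneNorm_le {f : K → K} {C : ℝ} (hC : 0 ≤ C)
    (h : ∀ x : K, ‖(f x : X)‖ ≤ C * ‖(x : X)‖) : coneNorm f ≤ C := by
  refine Real.sSup_le ?_ hC
  rintro t ⟨x, hx, rfl⟩
  simpa [hx] using h x

theorem coneSpectralRadius_nonneg (f : K → K) : 0 ≤ coneSpectralRadius f :=
  Real.sInf_nonneg (by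
    rintro t ⟨n, -, rfl⟩
    exact Real.rpow_nonneg (coneNorm_nonneg _) _)

theorem coneSpectralRadius_le {f : K → K} {C : ℝ} (hC : 0 ≤ C)
    (h : ∀ x : K, ‖(f x : X)‖ ≤ C * ‖(x : X)‖) : coneSpectralRadius f ≤ C := by
  have hb : BddBelow {t : ℝ | ∃ n : ℕ, 0 < n ∧ t = coneNorm (f^[n]) ^ (1 / (n : ℝ))} := by
    refine ⟨0, ?_⟩
    rintro t ⟨n, -, rfl⟩
    exact Real.rpow_nonneg (coneNorm_nonneg _) _
  exact csInf_le_of_le hb ⟨1, one_pos, rfl⟩ (by simpa using coneNorm_le hC h)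

theorem iterate_norm_le {f : K → K} {C : ℝ} (hC : 0 ≤ C)
    (h : ∀ x : K, ‖(f x : X)‖ ≤ C * ‖(x : X)‖) (n : ℕ) (x : K) :
    ‖(f^[n] x : X)‖ ≤ C ^ n * ‖(x : X)‖ := by
  induction n with
  | zero => simp
  | succ n ih =>
    rw [Function.iterate_succ_apply', pow_succ', mul_assoc]
    exact (h _).trans (mul_le_mul_of_nonneg_left ih hC)

theorem iterate_sub_pow_smul_mem {f : K → K} (hm : OrderPreserving f) (hf : Homogeneous f) {a : ℝ}
    (ha : 0 < a) {x : K} (h : (f x : X) - a • (x : X) ∈ K) (n : ℕ) :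
    (f^[n] x : X) - a ^ n • (x : X) ∈ K := by
  induction n with
  | zero => simp
  | succ n ih =>
    have hp : 0 < a ^ n := pow_pos ha n
    have h1 := hm ⟨a ^ n • (x : X), K.smul_mem x.2 hp.le⟩ (f^[n] x) ih
    rw [hf _ hp x] at h1
    have e : (f^[n + 1] x : X) - a ^ (n + 1) • (x : X) =
        ((f (f^[n] x) : X) - a ^ n • (f x : X)) + a ^ n • ((f x : X) - a • (x : X)) := by
      rw [Function.iterate_succ_apply', pow_succ]
      module
    rw [e]
    exact K.add_mem h1 (K.smul_mem h hp.le)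

theorem tendsto_const_mul_pow_rpow {C τ : ℝ} (hC : 0 < C) (hτ : 0 ≤ τ) :
    Tendsto (fun n : ℕ => (C * τ ^ n) ^ (1 / (n : ℝ))) atTop (𝓝 τ) := by
  have hlim : Tendsto (fun n : ℕ => C ^ (1 / (n : ℝ)) * τ) atTop (𝓝 (C ^ (0 : ℝ) * τ)) :=
    ((Real.continuousAt_const_rpow hC.ne').tendsto.comp
      tendsto_one_div_atTop_nhds_zero_nat).mul_const τ
  rw [Real.rpow_zero, one_mul] at hlim
  refine hlim.congr' ?_
  filter_upwards [eventually_gt_atTop 0] with n hn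
  rw [Real.mul_rpow hC.le (by positivity), one_div, Real.pow_rpow_inv_natCast hτ hn.ne']

/-- Iteration gives f^n(x) ≥ a^n x. Applying φ bounds ‖f^n‖ below by a constant times a^n, and the
constant disappears under n-th roots. -/
theorem le_coneSpectralRadius {φ : StrongDual ℝ X} {c : ℝ} (hc : 0 < c)
    (hφ : ∀ x ∈ K, c * ‖x‖ ≤ φ x) {f : K → K} (hm : OrderPreserving f) (hf : Homogeneous f) {C : ℝ}
    (hC : 0 ≤ C) (hb : ∀ x : K, ‖(f x : X)‖ ≤ C * ‖(x : X)‖) {a : ℝ} (ha : 0 < a) {x : K}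
    (hx : (x : X) ≠ 0) (h : (f x : X) - a • (x : X) ∈ K) : a ≤ coneSpectralRadius f := by
  have hxn : 0 < ‖(x : X)‖ := norm_pos_iff.2 hx
  have hxp : 0 < φ x := functional_pos hc hφ x.2 hx
  have hφn : 0 < ‖φ‖ * ‖(x : X)‖ :=
    hxp.trans_le ((le_abs_self _).trans (φ.le_opNorm x))
  refine le_of_tendsto_of_tendsto' (tendsto_const_mul_pow_rpow (C := φ x / (‖φ‖ * ‖(x : X)‖))
    (div_pos hxp hφn) ha.le) (tendsto_coneSpectralRadius hf (bddAbove_of_norm_le hb)) fun n => ?_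
  refine Real.rpow_le_rpow (by positivity) ?_ (by positivity)
  rw [div_mul_eq_mul_div, div_le_iff₀ hφn]
  have h1 := functional_nonneg hc hφ (iterate_sub_pow_smul_mem hm hf ha h n)
  rw [map_sub, map_smul, smul_eq_mul, sub_nonneg] at h1
  have h2 := norm_le_coneNorm (hf.iterate n) (bddAbove_of_norm_le (iterate_norm_le hC hb n)) x
  calc φ x * a ^ n ≤ φ (f^[n] x) := by rwa [mul_comm]
    _ ≤ ‖φ‖ * ‖(f^[n] x : X)‖ := (le_abs_self _).trans (φ.le_opNorm _)
    _ ≤ ‖φ‖ * (coneNorm f^[n] * ‖(x : X)‖) := mul_le_mul_of_nonneg_left h2 (norm_nonneg _)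
    _ = coneNorm f^[n] * (‖φ‖ * ‖(x : X)‖) := by ring

section GeneralizedSpectralRadius

variable {A : Set (K → K)} {C τ : ℝ}

theorem rpow_coneSpectralRadius_le (hC : 0 ≤ C) (hτ : 0 ≤ τ)
    (h : ∀ n, ∀ f ∈ familyPow A n, ∀ x : K, ‖(f x : X)‖ ≤ C * τ ^ n * ‖(x : X)‖) {n : ℕ}
    {f : K → K} (hf : f ∈ familyPow A n) :
    coneSpectralRadius f ^ (1 / (n : ℝ)) ≤ (C * τ ^ n) ^ (1 / (n : ℝ)) :=
  Real.rpow_le_rpow (coneSpectralRadius_nonneg f)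
    (coneSpectralRadius_le (by positivity) (h n f hf)) (by positivity)

theorem sSup_rpow_coneSpectralRadius_nonneg (n : ℕ) :
    0 ≤ sSup {t : ℝ | ∃ f ∈ familyPow A n, t = coneSpectralRadius f ^ (1 / (n : ℝ))} :=
  Real.sSup_nonneg (by
    rintro t ⟨f, -, rfl⟩
    exact Real.rpow_nonneg (coneSpectralRadius_nonneg f) _)

theorem sSup_rpow_coneSpectralRadius_le (hC : 0 ≤ C) (hτ : 0 ≤ τ)
    (h : ∀ n, ∀ f ∈ familyPow A n, ∀ x : K, ‖(f x : X)‖ ≤ C * τ ^ n * ‖(x : X)‖) (n : ℕ) :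
    sSup {t : ℝ | ∃ f ∈ familyPow A n, t = coneSpectralRadius f ^ (1 / (n : ℝ))} ≤
      (C * τ ^ n) ^ (1 / (n : ℝ)) := by
  refine Real.sSup_le ?_ (by positivity)
  rintro t ⟨f, hf, rfl⟩
  exact rpow_coneSpectralRadius_le hC hτ h hf

/-- Real suprema and upper limits take default values on unbounded data, so lower bounds on them
need this. -/
theorem isBoundedUnder_sSup_rpow_coneSpectralRadius (hC : 0 < C) (hτ : 0 ≤ τ)
    (h : ∀ n, ∀ f ∈ familyPow A n, ∀ x : K, ‖(f x : X)‖ ≤ C * τ ^ n * ‖(x : X)‖) :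
    IsBoundedUnder (· ≤ ·) atTop fun n : ℕ =>
      sSup {t : ℝ | ∃ f ∈ familyPow A n, t = coneSpectralRadius f ^ (1 / (n : ℝ))} :=
  (tendsto_const_mul_pow_rpow hC hτ).isBoundedUnder_le.mono_le
    (Eventually.of_forall (sSup_rpow_coneSpectralRadius_le hC.le hτ h))

theorem generalizedSpectralRadius_le (hC : 0 < C) (hτ : 0 ≤ τ)
    (h : ∀ n, ∀ f ∈ familyPow A n, ∀ x : K, ‖(f x : X)‖ ≤ C * τ ^ n * ‖(x : X)‖) :
    generalizedSpectralRadius A ≤ τ := by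
  rw [← (tendsto_const_mul_pow_rpow hC hτ).limsup_eq]
  exact limsup_le_limsup (Eventually.of_forall (sSup_rpow_coneSpectralRadius_le hC.le hτ h))
    (isCoboundedUnder_le_of_le atTop sSup_rpow_coneSpectralRadius_nonneg)
    (tendsto_const_mul_pow_rpow hC hτ).isBoundedUnder_le

theorem generalizedSpectralRadius_nonneg (hC : 0 < C) (hτ : 0 ≤ τ)
    (h : ∀ n, ∀ f ∈ familyPow A n, ∀ x : K, ‖(f x : X)‖ ≤ C * τ ^ n * ‖(x : X)‖) :
    0 ≤ generalizedSpectralRadius A :=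
  le_limsup_of_frequently_le (Eventually.of_forall sSup_rpow_coneSpectralRadius_nonneg).frequently
    (isBoundedUnder_sSup_rpow_coneSpectralRadius hC hτ h)

theorem le_generalizedSpectralRadius {φ : StrongDual ℝ X} {c : ℝ} (hc : 0 < c)
    (hφ : ∀ x ∈ K, c * ‖x‖ ≤ φ x) (hAm : ∀ f ∈ A, OrderPreserving f)
    (hAh : ∀ f ∈ A, Homogeneous f) (hC : 0 < C) (hτ : 0 ≤ τ)
    (h : ∀ n, ∀ f ∈ familyPow A n, ∀ x : K, ‖(f x : X)‖ ≤ C * τ ^ n * ‖(x : X)‖) {n : ℕ}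
    (hn : 1 ≤ n) {f : K → K} (hf : f ∈ familyPow A n) {x : K} (hx : (x : X) ≠ 0) {a : ℝ}
    (ha : 0 < a) (hfx : (f x : X) - a ^ n • (x : X) ∈ K) : a ≤ generalizedSpectralRadius A := by
  -- Powers of the single product f have arbitrarily large lengths, which is all an upper limit
  -- needs.
  refine le_limsup_of_frequently_le (frequently_atTop.2 fun N => ⟨(N + 1) * n, by nlinarith, ?_⟩)
    (isBoundedUnder_sSup_rpow_coneSpectralRadius hC hτ h)
  have hfm := orderPreserving_of_mem_familyPow hAm hf
  have hfh := homogeneous_of_mem_familyPow hAh hf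
  have hmem := iterate_mem_familyPow hf (N + 1)
  have h1 := iterate_sub_pow_smul_mem hfm hfh (pow_pos ha n) hfx (N + 1)
  have h2 := le_coneSpectralRadius hc hφ (orderPreserving_of_mem_familyPow hAm hmem)
    (homogeneous_of_mem_familyPow hAh hmem) (by positivity) (h _ _ hmem)
    (pow_pos (pow_pos ha n) _) hx h1
  rw [← pow_mul, mul_comm n] at h2
  have hn0 : (N + 1) * n ≠ 0 := by positivity
  refine le_csSup_of_le ⟨(C * τ ^ ((N + 1) * n)) ^ (1 / (((N + 1) * n : ℕ) : ℝ)), ?_⟩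
    ⟨_, hmem, rfl⟩ ?_
  rotate_left
  · calc a = (a ^ ((N + 1) * n)) ^ (1 / (((N + 1) * n : ℕ) : ℝ)) := by
          rw [one_div, Real.pow_rpow_inv_natCast ha.le hn0]
      _ ≤ _ := Real.rpow_le_rpow (by positivity) h2 (by positivity)
  · rintro t ⟨g, hg, rfl⟩
    exact rpow_coneSpectralRadius_le hC.le hτ h hg

end GeneralizedSpectralRadius

theorem familyPow_norm_le {A : Set (K → K)} {M : ℝ} (hM : 0 ≤ M)
    (hA : ∀ f ∈ A, ∀ x : K, ‖(f x : X)‖ ≤ M * ‖(x : X)‖) (n : ℕ) (f : K → K)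
    (hf : f ∈ familyPow A n) (x : K) : ‖(f x : X)‖ ≤ 1 * M ^ n * ‖(x : X)‖ := by
  induction n generalizing f with
  | zero =>
    obtain rfl : f = id := hf
    simp
  | succ n ih =>
    obtain ⟨h, hh, k, hk, rfl⟩ := hf
    calc ‖(h (k x) : X)‖ ≤ M * ‖(k x : X)‖ := hA h hh _
      _ ≤ M * (1 * M ^ n * ‖(x : X)‖) := mul_le_mul_of_nonneg_left (ih k hk) hM
      _ = _ := by ring

/-- The rates `θ > 0` such that products of `n` members of `A` have norm `O(θ ^ n)`. -/
def growthRates (A : Set (K → K)) : Set ℝ :=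
  {θ | 0 < θ ∧ ∃ C, 0 < C ∧ ∀ n, ∀ f ∈ familyPow A n, ∀ x : K,
    ‖(f x : X)‖ ≤ C * θ ^ n * ‖(x : X)‖}

theorem norm_le_of_functional_le {φ : StrongDual ℝ X} {c : ℝ} (hc : 0 < c)
    (hφ : ∀ x ∈ K, c * ‖x‖ ≤ φ x) {a : ℝ} (ha : 0 ≤ a) {x y : K} (h : φ y ≤ a * φ x) :
    ‖(y : X)‖ ≤ a * (‖φ‖ / c) * ‖(x : X)‖ := by
  have h1 := (hφ y y.2).trans (h.trans (mul_le_mul_of_nonneg_left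
    ((le_abs_self _).trans (φ.le_opNorm x)) ha))
  rw [mul_comm, ← le_div_iff₀ hc] at h1
  exact h1.trans_eq (by ring)

theorem functional_le_of_norm_le {φ : StrongDual ℝ X} {c : ℝ} (hc : 0 < c)
    (hφ : ∀ x ∈ K, c * ‖x‖ ≤ φ x) {a : ℝ} (ha : 0 ≤ a) {x y : K} (h : ‖(y : X)‖ ≤ a * ‖(x : X)‖) :
    φ y ≤ a * (‖φ‖ / c) * φ x := by
  have h0 : ‖(x : X)‖ ≤ φ x / c := by
    rw [le_div_iff₀ hc, mul_comm]
    exact hφ x x.2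
  calc φ y ≤ ‖φ‖ * ‖(y : X)‖ := (le_abs_self _).trans (φ.le_opNorm y)
    _ ≤ ‖φ‖ * (a * (φ x / c)) := mul_le_mul_of_nonneg_left
        (h.trans (mul_le_mul_of_nonneg_left h0 ha)) (norm_nonneg _)
    _ = _ := by ring

theorem mem_growthRates_of_path_bound {φ : StrongDual ℝ X} {c : ℝ} (hc : 0 < c)
    (hφ : ∀ x ∈ K, c * ‖x‖ ≤ φ x) {A : Set (K → K)} {θ D : ℝ} (hθ : 0 < θ) (hD : 0 ≤ D)
    (h : ∀ n z, IsPath A K n z → φ (z n) ≤ D * θ ^ n * φ (z 0)) : θ ∈ growthRates A := by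
  -- The summand 1 keeps the constant positive even if D or φ vanishes.
  refine ⟨hθ, D * (‖φ‖ / c) + 1, by positivity, fun n f hf x => ?_⟩
  obtain ⟨z, hz, hz0, hzn⟩ := exists_isPath hf x
  have h1 := h n z hz
  rw [hz0, hzn] at h1
  have h2 := norm_le_of_functional_le hc hφ (by positivity) h1
  refine h2.trans (mul_le_mul_of_nonneg_right ?_ (norm_nonneg _))
  have : 0 < θ ^ n := pow_pos hθ n
  nlinarith

variable [FiniteDimensional ℝ X]

theorem IsCompactFamily.growthRates_nonempty {A : Set (K → K)} (hA : IsCompactFamily A) :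
    (growthRates A).Nonempty := by
  obtain ⟨M, hM0, hM⟩ := hA.exists_norm_le
  refine ⟨M + 1, by positivity, 1, one_pos, familyPow_norm_le (by positivity) fun f hf x => ?_⟩
  exact (hM f hf x).trans (mul_le_mul_of_nonneg_right (by linarith) (norm_nonneg _))

theorem IsCompactFamily.exists_functional_le {φ : StrongDual ℝ X} {c : ℝ} (hc : 0 < c)
    (hφ : ∀ x ∈ K, c * ‖x‖ ≤ φ x) {A : Set (K → K)} (hA : IsCompactFamily A) (τ : ℝ) :
    ∃ M : ℝ, 1 ≤ M ∧ τ ≤ M ∧ ∀ f ∈ A, ∀ x : K, φ (f x) ≤ M * φ x := by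
  obtain ⟨M, hM0, hM⟩ := hA.exists_norm_le
  refine ⟨max (max 1 τ) (M * (‖φ‖ / c)), (le_max_left _ _).trans (le_max_left _ _),
    (le_max_right _ _).trans (le_max_left _ _), fun f hf x => ?_⟩
  exact (functional_le_of_norm_le hc hφ hM0 (hM f hf x)).trans
    (mul_le_mul_of_nonneg_right (le_max_right _ _) (functional_nonneg hc hφ x.2))

theorem IsCompactFamily.generalizedSpectralRadius_nonneg {A : Set (K → K)}
    (hA : IsCompactFamily A) : 0 ≤ generalizedSpectralRadius A := by
  obtain ⟨M, hM0, hM⟩ := hA.exists_norm_le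
  exact ConeMaps.generalizedSpectralRadius_nonneg one_pos hM0 (familyPow_norm_le hM0 hM)

/-! ### Semicontinuity from above and below -/

section Limits

variable {A : ℕ → Set (K → K)} {B : Set (K → K)} {φ : StrongDual ℝ X} {c : ℝ}

theorem eventually_generalizedSpectralRadius_le (hc : 0 < c) (hφ : ∀ x ∈ K, c * ‖x‖ ≤ φ x)
    (hA : ∀ k, IsCompactFamily (A k)) (hB : IsCompactFamily B)
    (hAB : Tendsto (fun k => Metric.hausdorffDist (restrictFamily (A k)) (restrictFamily B))
      atTop (𝓝 0)) {θ τ : ℝ} (hθ : θ ∈ growthRates B) (hθτ : θ < τ) :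
    ∀ᶠ k in atTop, generalizedSpectralRadius (A k) ≤ τ := by
  have : ProperSpace X := FiniteDimensional.proper_real X
  obtain ⟨hθ0, C, hC, hbound⟩ := hθ
  have hτ0 : 0 < τ := hθ0.trans hθτ
  set E := C * (‖φ‖ / c) with hE
  obtain ⟨n, hn⟩ := pow_unbounded_of_one_lt (max E 1) ((one_lt_div hθ0).2 hθτ)
  have hn1 : 1 ≤ n := by
    rcases Nat.eq_zero_or_pos n with rfl | h
    · simp at hn
    · exact h
  have hEn : E * θ ^ n < τ ^ n := by
    have := (le_max_left E 1).trans_lt hn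
    rwa [div_pow, lt_div_iff₀ (pow_pos hθ0 n)] at this
  -- Violations for infinitely many k, normalized to unit vectors, would subconverge to one for B,
  -- against E * θ ^ n < τ ^ n.
  have hshort : ∀ᶠ k in atTop, ∀ f ∈ familyPow (A k) n, ∀ x : K, φ (f x) ≤ τ ^ n * φ x := by
    by_contra hcon
    obtain ⟨ψ, hψ, hbad⟩ := extraction_of_frequently_atTop (not_eventually.1 hcon)
    push Not at hbad
    choose f hf x hx using hbad
    have hfh := fun j => homogeneous_of_mem_familyPow (hA (ψ j)).homogeneous (hf j)
    have hx0 : ∀ j, (x j : X) ≠ 0 := fun j h0 => by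
      have := hx j
      rw [h0, (hfh j).map_zero _ h0, map_zero, mul_zero] at this
      exact lt_irrefl _ this
    have hxn : ∀ j, 0 < ‖(x j : X)‖ := fun j => norm_pos_iff.2 (hx0 j)
    set y : ℕ → K := fun j => ⟨‖(x j : X)‖⁻¹ • (x j : X), K.smul_mem (x j).2 (inv_pos.2 (hxn j)).le⟩
      with hy
    have hyn : ∀ j, ‖(y j : X)‖ = 1 := fun j => by simp [hy, norm_smul, (hxn j).ne']
    have hyf : ∀ j, τ ^ n * φ (y j) < φ (f j (y j)) := fun j => by
      rw [hfh j _ (inv_pos.2 (hxn j)) (x j), map_smul, map_smul, smul_eq_mul, smul_eq_mul,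
        mul_left_comm]
      exact mul_lt_mul_of_pos_left (hx j) (inv_pos.2 (hxn j))
    obtain ⟨y₀, hy₀, ψ₁, hψ₁, hlim₁⟩ := ((isCompact_sphere (0 : X) 1).inter_left K.isClosed
      ).tendsto_subseq (x := fun j => (y j : X)) fun j => ⟨(y j).2, by simp [hyn j]⟩
    have hlim₁' : Tendsto (y ∘ ψ₁) atTop (𝓝 (⟨y₀, hy₀.1⟩ : K)) := tendsto_subtype_rng.2 hlim₁
    obtain ⟨g, hg, ψ₂, hψ₂, hlim₂⟩ := exists_subseq_tendsto_familyPow hA hB hAB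
      (hψ.comp hψ₁) (fun j => hf (ψ₁ j)) hlim₁'
    have h1 : τ ^ n * φ y₀ ≤ φ (g ⟨y₀, hy₀.1⟩) := le_of_tendsto_of_tendsto'
      (((φ.continuous.tendsto _).comp (hlim₁.comp hψ₂.tendsto_atTop)).const_mul (τ ^ n))
      ((φ.continuous.tendsto _).comp (tendsto_subtype_rng.1 hlim₂))
      fun j => (hyf (ψ₁ (ψ₂ j))).le
    have h2 := functional_le_of_norm_le hc hφ (by positivity) (hbound n g hg ⟨y₀, hy₀.1⟩)
    have hy0 : 0 < φ y₀ := functional_pos hc hφ hy₀.1 (by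
      rintro rfl
      simpa using hy₀.2)
    have h3 : E * θ ^ n * φ y₀ < τ ^ n * φ y₀ := mul_lt_mul_of_pos_right hEn hy0
    have h4 : C * θ ^ n * (‖φ‖ / c) * φ y₀ = E * θ ^ n * φ y₀ := by
      rw [hE]
      ring
    exact absurd (h1.trans (h2.trans_eq h4)) (not_le.2 h3)
  filter_upwards [hshort] with k hk
  obtain ⟨M, hM1, hτM, hM⟩ := (hA k).exists_functional_le hc hφ τ
  have hM0 : 0 ≤ M := zero_le_one.trans hM1
  obtain ⟨-, D, hD, hD'⟩ := mem_growthRates_of_path_bound hc hφ hτ0 (D := (M / τ) ^ n)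
    (by positivity) (growth_bound_of_length (fun x hx => functional_nonneg hc hφ hx) hM0 hM hτ0 hτM
      hn1 fun z hz => by
        obtain ⟨f, hf, hfz⟩ := hz.exists_mem_familyPow (hz.1 0 (Nat.zero_le _))
        rw [← hfz]
        exact hk f hf _)
  exact generalizedSpectralRadius_le hD hτ0.le hD'

theorem eventually_lt_generalizedSpectralRadius (hc : 0 < c) (hφ : ∀ x ∈ K, c * ‖x‖ ≤ φ x)
    {s : Finset X} (hs : ∀ v ∈ s, v ∈ K ∧ φ v = 1)
    (hgen : ∀ x ∈ K, ∃ w : X → ℝ, (∀ v ∈ s, 0 ≤ w v) ∧ x = ∑ v ∈ s, w v • v)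
    (hA : ∀ k, IsCompactFamily (A k)) (hAm : ∀ k, ∀ f ∈ A k, OrderPreserving f)
    (hB : IsCompactFamily B)
    (hAB : Tendsto (fun k => Metric.hausdorffDist (restrictFamily (A k)) (restrictFamily B))
      atTop (𝓝 0)) {ν : ℝ} (hν0 : 0 < ν) (hν : ν < sInf (growthRates B)) :
    ∀ᶠ k in atTop, ν ≤ generalizedSpectralRadius (A k) := by
  obtain ⟨τ, hντ, hτ⟩ := exists_between hν
  obtain ⟨μ, hνμ, hμτ⟩ := exists_between hντ
  have hμ0 : 0 < μ := hν0.trans hνμ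
  obtain ⟨M, hM1, hτM, hM⟩ := hB.exists_functional_le hc hφ τ
  have hgrow : HasGrowth B φ τ K := by
    -- Otherwise a rate below τ would be admissible, under the infimum.
    by_contra hnot
    obtain ⟨θ, D, hθ, -, hθτ, hD, hbound⟩ := exists_growth_bound hc hφ hB.homogeneous
      (zero_le_one.trans hM1) hM Subset.rfl (fun a ha x hx => K.smul_mem hx ha.le) hτM hμτ hnot
    exact absurd (csInf_le ⟨0, fun t ht => ht.1.le⟩
      (mem_growthRates_of_path_bound hc hφ hθ (zero_le_one.trans hD) hbound))
      (not_le.2 (hθτ.trans hτ))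
  obtain ⟨n, hn, f, hf, x, hx, hfx⟩ := exists_expanding_of_hasGrowth hc hφ hs hgen
    (fun f hf => orderPreserving_of_tendsto_hausdorffDist hA hAm hB hAB hf) hB.homogeneous hM1 hM
    hB.isClosed_step hμ0.le hμτ hτM hgrow
  -- The room between ν and μ absorbs the perturbation: g(x) ≥ (ν / μ)^n f(x) ≥ ν^n x.
  have hratio : (ν / μ) ^ n < 1 :=
    pow_lt_one₀ (by positivity) ((div_lt_one hμ0).2 hνμ) (Nat.one_le_iff_ne_zero.1 hn)
  obtain ⟨δ, hδ, hball⟩ := exists_forall_sub_smul_mem hs hgen (f x : X) hratio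
  obtain ⟨g, hg, hglim⟩ := exists_approx_familyPow hA hB hAB hf
  have hlim := tendsto_subtype_rng.1 (hglim (fun _ => x) x tendsto_const_nhds)
  filter_upwards [(Metric.tendsto_nhds.1 hlim) δ hδ] with k hk
  rw [dist_eq_norm] at hk
  have h1 := hball _ (g k x).2 hk
  obtain ⟨N, hN0, hN⟩ := (hA k).exists_norm_le
  refine le_generalizedSpectralRadius hc hφ (hAm k) (hA k).homogeneous one_pos hN0
    (familyPow_norm_le hN0 hN) hn (hg k) hx hν0 ?_
  have h2 := K.smul_mem hfx (show 0 ≤ (ν / μ) ^ n by positivity)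
  have h3 := K.add_mem h1 h2
  rw [smul_sub, smul_smul, ← mul_pow, div_mul_cancel₀ _ hμ0.ne', sub_add_sub_cancel] at h3
  exact h3

/-- The limit is expressed by growth rates so that constant sequences can identify it with the
spectral radius. -/
theorem tendsto_generalizedSpectralRadius_sInf_growthRates (hc : 0 < c)
    (hφ : ∀ x ∈ K, c * ‖x‖ ≤ φ x)
    {s : Finset X} (hs : ∀ v ∈ s, v ∈ K ∧ φ v = 1)
    (hgen : ∀ x ∈ K, ∃ w : X → ℝ, (∀ v ∈ s, 0 ≤ w v) ∧ x = ∑ v ∈ s, w v • v)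
    (hA : ∀ k, IsCompactFamily (A k)) (hAm : ∀ k, ∀ f ∈ A k, OrderPreserving f)
    (hB : IsCompactFamily B)
    (hAB : Tendsto (fun k => Metric.hausdorffDist (restrictFamily (A k)) (restrictFamily B))
      atTop (𝓝 0)) :
    Tendsto (fun k => generalizedSpectralRadius (A k)) atTop (𝓝 (sInf (growthRates B))) := by
  refine tendsto_order.2 ⟨fun a ha => ?_, fun a ha => ?_⟩
  · rcases lt_or_ge a 0 with h | h
    · exact Eventually.of_forall fun k => h.trans_le (hA k).generalizedSpectralRadius_nonneg
    · obtain ⟨ν, haν, hν⟩ := exists_between ha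
      filter_upwards [eventually_lt_generalizedSpectralRadius hc hφ hs hgen hA hAm hB hAB
        (h.trans_lt haν) hν] with k hk
      exact haν.trans_le hk
  · obtain ⟨θ, hθ, hθa⟩ := exists_lt_of_csInf_lt hB.growthRates_nonempty ha
    obtain ⟨τ, hθτ, hτa⟩ := exists_between hθa
    filter_upwards [eventually_generalizedSpectralRadius_le hc hφ hA hB hAB hθ hθτ] with k hk
    exact hk.trans_lt hτa

end Limits

end ConeMaps

end

theorem mainTheorem2 {X : Type*} [NormedAddCommGroup X] [NormedSpace ℝ X] [FiniteDimensional ℝ X]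
    (K : ProperCone ℝ X) (hK : ConeMaps.IsPolyhedralCone K)
    (A : ℕ → Set (K → K)) (hA : ∀ k, ConeMaps.IsCompactFamily (A k))
    (hA_mono : ∀ k, ∀ f ∈ A k, ConeMaps.OrderPreserving f)
    (B : Set (K → K)) (hB : ConeMaps.IsCompactFamily B)
    (hAB : Filter.Tendsto
      (fun k => Metric.hausdorffDist (ConeMaps.restrictFamily (A k)) (ConeMaps.restrictFamily B))
      Filter.atTop (nhds 0)) :
    Filter.Tendsto (fun k => ConeMaps.generalizedSpectralRadius (A k)) Filter.atTop
      (nhds (ConeMaps.generalizedSpectralRadius B)) := by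
  obtain ⟨φ, c, hc, hφ⟩ := ConeMaps.exists_bounded_below_functional hK.inter_neg
  obtain ⟨s, hs, hgen⟩ := ConeMaps.exists_finset_generators hK.finite_extremeRays hc hφ
  have hB_mono : ∀ f ∈ B, ConeMaps.OrderPreserving f := fun f hf =>
    ConeMaps.orderPreserving_of_tendsto_hausdorffDist hA hA_mono hB hAB hf
  -- A constant sequence converges to its value, so r(B) is the infimum of the growth rates.
  have hconst := ConeMaps.tendsto_generalizedSpectralRadius_sInf_growthRates (A := fun _ => B) hc hφ
    hs hgen (fun _ => hB) (fun _ => hB_mono) hB (by simp)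
  rw [tendsto_nhds_unique tendsto_const_nhds hconst]
  exact ConeMaps.tendsto_generalizedSpectralRadius_sInf_growthRates hc hφ hs hgen hA hA_mono hB hAB
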